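/- Let $K$ be a field complete with respect to a nontrivial non-archimedean absolute value $|\cdot|$, with residue field $k$, and suppose that $k$ is not an algebraic extension of a finite field. Let $\mathbb{C}_K$ be the completion of an algebraic closure of $K$, let $\hat k$ be its residue field, and let $\mathrm{red}:\mathbb{P}^1(\mathbb{C}_K)\to\mathbb{P}^1(\hat k)$ be the reduction map, with residue classes $W_{\bar a}=\mathrm{red}^{-1}(\bar a)$. A rational function $\phi\in\mathbb{C}_K(z)$ has nontrivial reduction $\bar\phi$ if, writing $\phi=f/g$ with $f,g$ polynomials with coefficients in $\{|x|\le 1\}$, some coefficient of $f$ or $g$ having absolute value $1$, and dividing the reductions $\bar f,\bar g\in\hat k[z]$ by their gcd to get $\bar f_0,\bar g_0$, the polynomials $\bar f_0,\bar g_0$ are not both constant; then $\bar\phi=\bar f_0/\bar g_0\in\hat k(z)$. The Fatou set $\mathcal F_\phi\subset\mathbb{P}^1(\mathbb{C}_K)$ is the set of points having a neighborhood on which $\{\phi^n:n\ge0\}$ is equicontinuous for the spherical metric, and the Julia set is its complement. A disk in $\mathbb{P}^1(\mathbb{C}_K)$ is an open or closed disk of positive radius in $\mathbb{C}_K$ or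 the complement of one; a disk $\{|z-a|<r\}$ or the complement of a disk $\{|z-a|\le r\}$ is rational open if $r\in|\mathbb{C}_K^*|$, and a disk $\{|z-a|\le r\}$ or the complement of a disk $\{|z-a|<r\}$ is rational closed if $r\in|\mathbb{C}_K^*|$. A connected affinoid is the complement of a finite (possibly empty) union of pairwise disjoint disks; it is rational open if these disks can be taken rational closed. For $x\in\mathcal F_\phi$, the analytic component (respectively, D-component) of $x$ is the union of all connected affinoids (respectively, disks) $W$ with $x\in W\subset\mathcal F_\phi$; the dynamical component (respectively, dynamical D-component) of $x$ is the union of all rational open connected affinoids (respectively, rational open disks) $W\ni x$ such that $\mathbb{P}^1(\mathbb{C}_K)\setminus\bigcup_{n\ge0}\phi^n(W)$ is infinite. For each of these four types, $\phi$ acts on the set of components by sending $U$ to the component $\Phi(U)$ containing $\phi(U)$. A component is wandering if it is not preperiodic under $\Phi$, and the grand orbit of $U$ is the set of components $V$ with $\Phi^m(U)=\Phi^n(V)$ for some $m,n\ge0$. 1. There exists $\phi\in K(z)$ which has nontrivial reduction $\bar\phi$ with $\deg\bar\phi\ge2$ and whose Julia set intersects infinitely many residue classes of $\mathbb{P}^1(\mathbb{C}_K)$.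 2. Let $m\ge2$ be an integer not divisible by the characteristic of $k$, let $T\in K$ with $0<|T|<1$, and let $$\phi(z)=z^m+\frac{T}{\Psi_m(z)},$$ where $\Psi_m$ is the $m$-th cyclotomic polynomial. Then $\phi$ has nontrivial reduction $\bar\phi(z)=z^m$; the Julia set of $\phi$ intersects infinitely many residue classes; and, for each of the four types of components, there are infinitely many grand orbits of wandering components of $\phi$. More precisely, for any $b\in K$ with $|b|\le1$ whose image $\bar b\in k$ is such that $\{\bar b^n\}_{n\in\mathbb{Z}}$ is infinite, the residue class $W_{\bar b}$ is a wandering component of $\phi$ of each of the four types. -/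

import Mathlib

open Polynomial

noncomputable section

/-! ### The field `ℂ_K` -/

section CompletedClosure

variable (K : Type*) [NontriviallyNormedField K] [IsUltrametricDist K] [CompleteSpace K]

/-- An algebraic closure of the complete non-archimedean field `K`, which carries the unique
extension of the absolute value of `K`. -/
def NormedAlgClosure (K : Type*) [NontriviallyNormedField K] [IsUltrametricDist K]
    [CompleteSpace K] : Type _ := AlgebraicClosure K

namespace NormedAlgClosure

instance instField : Field (NormedAlgClosure K) := inferInstanceAs (Field (AlgebraicClosure K))

instance instAlgebra : Algebra K (NormedAlgClosure K) :=
  inferInstanceAs (Algebra K (AlgebraicClosure K))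

instance instIsAlgebraic : Algebra.IsAlgebraic K (NormedAlgClosure K) :=
  AlgebraicClosure.isAlgebraic K

instance instIsAlgClosed : IsAlgClosed (NormedAlgClosure K) :=
  inferInstanceAs (IsAlgClosed (AlgebraicClosure K))

instance instNormedField : NormedField (NormedAlgClosure K) :=
  spectralNorm.normedField K (NormedAlgClosure K)

instance instNormedAlgebra : NormedAlgebra K (NormedAlgClosure K) :=
  spectralNorm.normedAlgebra K (NormedAlgClosure K)

instance instUniformContinuousConstSMul : UniformContinuousConstSMul K (NormedAlgClosure K) :=
  uniformContinuousConstSMul_of_continuousConstSMul K (NormedAlgClosure K)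

end NormedAlgClosure

/-- `ℂ_K`, the completion of an algebraic closure of `K`. -/
abbrev CompletedAlgClosure (K : Type*) [NontriviallyNormedField K] [IsUltrametricDist K]
    [CompleteSpace K] : Type _ := UniformSpace.Completion (NormedAlgClosure K)

instance CompletedAlgClosure.instIsUltrametricDist : IsUltrametricDist (CompletedAlgClosure K) :=
  IsUltrametricDist.of_normedAlgebra K

end CompletedClosure

/-! ### Residue fields, the projective line, rational functions -/

/-- The ring of integers `{x : |x| ≤ 1}` of a non-archimedean field. -/
abbrev RingInt (L : Type*) [NormedField L] [IsUltrametricDist L] : ValuationSubring L :=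
  (NormedField.valuation (K := L)).valuationSubring

/-- The residue field of a non-archimedean field. -/
abbrev ResField (L : Type*) [NormedField L] [IsUltrametricDist L] : Type _ :=
  IsLocalRing.ResidueField (RingInt L)

/-- The field `k` is an algebraic extension of a finite field. -/
def IsAlgebraicOverFiniteField (k : Type*) [Field k] : Prop :=
  ∃ F : Subfield k, Finite F ∧ Algebra.IsAlgebraic F k

/-- The projective line `L ∪ {∞}`, as a set (no topology on it is used; distances are measured
by `sphericalDist`). -/
abbrev P1 (L : Type*) : Type _ := OnePoint L

/-- The degree of a rational function. -/
def ratDegree {L : Type*} [Field L] (φ : RatFunc L) : ℕ :=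
  max φ.num.natDegree φ.denom.natDegree

open Classical in
/-- The action of a rational function on the projective line. -/
def ratAct {L : Type*} [Field L] (φ : RatFunc L) : P1 L → P1 L
  | OnePoint.infty =>
      if φ.denom.natDegree < φ.num.natDegree then OnePoint.infty
      else ((φ.num.coeff φ.denom.natDegree / φ.denom.coeff φ.denom.natDegree : L) : OnePoint L)
  | OnePoint.some x =>
      if φ.denom.eval x = 0 then OnePoint.infty
      else ((φ.num.eval x / φ.denom.eval x : L) : OnePoint L)

/-- A rational function over `K`, viewed as a rational function over an extension `L` of `K`. -/
def ratBaseChange (K L : Type*) [Field K] [Field L] [Algebra K L] (φ : RatFunc K) : RatFunc L :=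
  algebraMap L[X] (RatFunc L) (φ.num.map (algebraMap K L)) /
    algebraMap L[X] (RatFunc L) (φ.denom.map (algebraMap K L))

section NonArch

variable {L : Type*} [NormedField L]

/-! ### Reduction -/

section Reduction

variable [IsUltrametricDist L]

open Classical in
/-- The reduction map from the projective line over `L` to that over the residue field. -/
def red : P1 L → P1 (ResField L)
  | OnePoint.infty => OnePoint.infty
  | OnePoint.some x =>
      if h : x ∈ RingInt L then
        ((IsLocalRing.residue (RingInt L) ⟨x, h⟩ : ResField L) : OnePoint (ResField L))
      else OnePoint.infty

/-- The residue class `W_a`. -/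
def residueClass (a : P1 (ResField L)) : Set (P1 L) := red ⁻¹' {a}

open Classical in
/-- The rational function `φ` has nontrivial reduction, and its reduction is `ψ`. -/
def HasNontrivialReduction (φ : RatFunc L) (ψ : RatFunc (ResField L)) : Prop :=
  ∃ f g : (RingInt L)[X], g ≠ 0 ∧
    φ = algebraMap L[X] (RatFunc L) (f.map (RingInt L).subtype) /
        algebraMap L[X] (RatFunc L) (g.map (RingInt L).subtype) ∧
    (∃ i, ‖(f.coeff i : L)‖ = 1 ∨ ‖(g.coeff i : L)‖ = 1) ∧
    ∃ fbar gbar h f₀ g₀ : (ResField L)[X],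
      fbar = f.map (IsLocalRing.residue (RingInt L)) ∧
      gbar = g.map (IsLocalRing.residue (RingInt L)) ∧
      h = EuclideanDomain.gcd fbar gbar ∧ f₀ = fbar / h ∧ g₀ = gbar / h ∧
      ¬ (f₀.natDegree = 0 ∧ g₀.natDegree = 0) ∧
      ψ = algebraMap (ResField L)[X] (RatFunc (ResField L)) f₀ /
          algebraMap (ResField L)[X] (RatFunc (ResField L)) g₀

end Reduction

/-! ### Fatou and Julia sets -/

/-- The spherical metric on the projective line. -/
def sphericalDist : P1 L → P1 L → ℝ
  | OnePoint.infty, OnePoint.infty => 0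
  | OnePoint.infty, OnePoint.some y => 1 / max 1 ‖y‖
  | OnePoint.some x, OnePoint.infty => 1 / max 1 ‖x‖
  | OnePoint.some x, OnePoint.some y => ‖x - y‖ / (max 1 ‖x‖ * max 1 ‖y‖)

/-- The family of iterates of `f` is equicontinuous at `y`. -/
def EquicontIteratesAt (f : P1 L → P1 L) (y : P1 L) : Prop :=
  ∀ ε > 0, ∃ δ > 0, ∀ y', sphericalDist y y' < δ →
    ∀ n : ℕ, sphericalDist (f^[n] y) (f^[n] y') < ε

/-- The Fatou set: the points that have a neighborhood on which the iterates of `φ` are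
equicontinuous. -/
def fatouSet (φ : RatFunc L) : Set (P1 L) :=
  {x | ∃ r > 0, ∀ y, sphericalDist x y < r → EquicontIteratesAt (ratAct φ) y}

/-- The Julia set. -/
def juliaSet (φ : RatFunc L) : Set (P1 L) := (fatouSet φ)ᶜ

/-! ### Disks and affinoids -/

/-- The open disk `D(a, r)` as a subset of the projective line. -/
def openDisk (a : L) (r : ℝ) : Set (P1 L) := (fun x : L => (x : OnePoint L)) '' {x | ‖x - a‖ < r}

/-- The closed disk of center `a` and radius `r` as a subset of the projective line. -/
def closedDisk (a : L) (r : ℝ) : Set (P1 L) := (fun x : L => (x : OnePoint L)) '' {x | ‖x - a‖ ≤ r}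

/-- The disks in the projective line: the disks `D(a, r)`, the closed disks, and the complements
of either. -/
def IsDisk (U : Set (P1 L)) : Prop :=
  ∃ (a : L) (r : ℝ), 0 < r ∧
    (U = openDisk a r ∨ U = closedDisk a r ∨ Uᶜ = openDisk a r ∨ Uᶜ = closedDisk a r)

/-- `r` belongs to the value group `|L^*|`. -/
def InValueGroup (L : Type*) [NormedField L] (r : ℝ) : Prop := ∃ c : L, c ≠ 0 ∧ ‖c‖ = r

/-- Rational open disks in the projective line. -/
def IsRationalOpenDisk (U : Set (P1 L)) : Prop :=
  ∃ (a : L) (r : ℝ), InValueGroup L r ∧ (U = openDisk a r ∨ Uᶜ = closedDisk a r)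

/-- Rational closed disks in the projective line. -/
def IsRationalClosedDisk (U : Set (P1 L)) : Prop :=
  ∃ (a : L) (r : ℝ), InValueGroup L r ∧ (U = closedDisk a r ∨ Uᶜ = openDisk a r)

/-- Connected affinoids: complements of finite unions of pairwise disjoint disks. -/
def IsConnectedAffinoid (W : Set (P1 L)) : Prop :=
  ∃ (N : ℕ) (U : Fin N → Set (P1 L)), (∀ i, IsDisk (U i)) ∧
    (∀ i j, i ≠ j → Disjoint (U i) (U j)) ∧ W = (⋃ i, U i)ᶜ

/-- Connected rational open affinoids: complements of finite unions of pairwise disjoint rational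
closed disks. -/
def IsRationalOpenConnectedAffinoid (W : Set (P1 L)) : Prop :=
  ∃ (N : ℕ) (U : Fin N → Set (P1 L)), (∀ i, IsRationalClosedDisk (U i)) ∧
    (∀ i j, i ≠ j → Disjoint (U i) (U j)) ∧ W = (⋃ i, U i)ᶜ

/-! ### The four types of components of the Fatou set -/

/-- The four types of Fatou components. -/
inductive CompType : Type
  | analytic
  | disk
  | dynamical
  | dynamicalDisk

/-- The sets whose union is the component containing `x`. -/
def IsComponentPiece (φ : RatFunc L) : CompType → Set (P1 L) → Prop
  | CompType.analytic, W => IsConnectedAffinoid W ∧ W ⊆ fatouSet φ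
  | CompType.disk, W => IsDisk W ∧ W ⊆ fatouSet φ
  | CompType.dynamical, W =>
      IsRationalOpenConnectedAffinoid W ∧ (⋃ n : ℕ, (ratAct φ)^[n] '' W)ᶜ.Infinite
  | CompType.dynamicalDisk, W =>
      IsRationalOpenDisk W ∧ (⋃ n : ℕ, (ratAct φ)^[n] '' W)ᶜ.Infinite

/-- The component of type `t` of the Fatou set containing `x` (for `x` in the Fatou set). -/
def componentAt (φ : RatFunc L) (t : CompType) (x : P1 L) : Set (P1 L) :=
  ⋃₀ {W | x ∈ W ∧ IsComponentPiece φ t W}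

/-- `V` is a component of type `t` of the Fatou set of `φ`. -/
def IsFatouComponent (φ : RatFunc L) (t : CompType) (V : Set (P1 L)) : Prop :=
  ∃ x ∈ fatouSet φ, x ∈ V ∧ V = componentAt φ t x

/-- The action of `φ` on components of type `t`: a component `U` is sent to the (unique) component
which contains `φ(U)`. -/
def componentMap (φ : RatFunc L) (t : CompType) (U : Set (P1 L)) : Set (P1 L) :=
  ⋃₀ {V | IsFatouComponent φ t V ∧ ratAct φ '' U ⊆ V}

/-- `V` is a wandering component of type `t`: it is not preperiodic under the action of `φ` on the
components of type `t`. -/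
def IsWanderingComponent (φ : RatFunc L) (t : CompType) (V : Set (P1 L)) : Prop :=
  IsFatouComponent φ t V ∧
    ¬ ∃ m : ℕ, (componentMap φ t)^[m] V ∈ Function.periodicPts (componentMap φ t)

/-- The grand orbit of the component `U` of type `t`. -/
def componentGrandOrbit (φ : RatFunc L) (t : CompType) (U : Set (P1 L)) : Set (Set (P1 L)) :=
  {V | IsFatouComponent φ t V ∧ ∃ m n : ℕ, (componentMap φ t)^[m] U = (componentMap φ t)^[n] V}

/-- The set of grand orbits of wandering components of type `t`. -/
def wanderingGrandOrbits (φ : RatFunc L) (t : CompType) : Set (Set (Set (P1 L))) :=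
  {S | ∃ U, IsWanderingComponent φ t U ∧ S = componentGrandOrbit φ t U}

end NonArch

/-! ### The hypotheses on `φ` and the example -/

section Main

variable {K : Type*} [NontriviallyNormedField K] [IsUltrametricDist K] [CompleteSpace K]

/-- `φ ∈ K(z)`, viewed as an element of `ℂ_K(z)`. -/
abbrev overCK (φ : RatFunc K) : RatFunc (CompletedAlgClosure K) :=
  ratBaseChange K (CompletedAlgClosure K) φ

/-- The Julia set of `φ` meets infinitely many residue classes. -/
def JuliaMeetsInfinitelyManyClasses (φ : RatFunc K) : Prop :=
  {a : P1 (ResField (CompletedAlgClosure K)) |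
    (juliaSet (overCK φ) ∩ residueClass a).Nonempty}.Infinite

/-- The function `z ^ m + T / Ψ_m(z)`, where `Ψ_m` is the `m`-th cyclotomic polynomial. -/
def exampleMap (m : ℕ) (T : K) : RatFunc K :=
  RatFunc.X ^ m + RatFunc.C T / algebraMap K[X] (RatFunc K) (cyclotomic m K)

end Main

end

/-! Write `φ(z) = z ^ m + T / Ψ_m(z)` and `L = ℂ_K`. The reduction of `φ` is `z ^ m`, and `φ` maps a
residue class of units `a` with `a ^ m` not reducing to `1` isometrically onto the residue class of
`a ^ m`: there `Ψ_m` is a unit, so the pole part is a small perturbation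
(`iterate_on_residueClass`, `exists_iterate_cyclotomicVal_eq`). On the class of a primitive `m`-th
root of unity `ζ` the pole dominates instead: this class is mapped onto the whole projective line
(`exists_ratAct_eq`) and contains a repelling fixed point (`exists_repelling_fixedPoint`). The
solutions of `η ^ (m ^ n) = ζ`, for varying `n`, have distinct reductions, and the class of such an
`η` is carried to that of `ζ` by `φ ^ n`. Hence infinitely many residue classes meet the Julia set
and are mapped onto the projective line by an iterate of `φ` (`exists_residueClass_seq`).

A disk in the projective line lies in one residue class or contains all but one of them, so a
connected affinoid lies in one residue class or contains all but finitely many. In the second case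
it contains one of the classes above, and so it can be a piece of a component of none of the four
types (`IsComponentPiece.exists_subset_residueClass`). On the other hand, if the reduction of `b` is
nonzero and not a root of unity, all iterates of `φ` are isometric on the residue class of `b`, and
the images are the residue classes of the powers `b ^ (m ^ n)`. So this class lies in the Fatou set,
is itself a piece of a component of each type, hence is a component, and it wanders. The classes of
the powers `b ^ (1 + m * n)` lie in distinct grand orbits, and such a `b` exists in `K` because the
residue field is not algebraic over a finite field.

Roots in prescribed residue classes come from `exists_root_norm_sub_lt_one`, which rests on the
fact that `ℂ_K` is algebraically closed, in any characteristic
(`IsAlgClosed.of_denseRange_of_completeSpace`). -/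

/-! ### Algebraic closedness of a completed algebraic closure -/

/-- A complete non-archimedean field with a dense algebraically closed subfield is algebraically
closed, in any characteristic: by continuity of roots, a root of a monic polynomial in a
splitting field is a limit of elements of the ground field, which is closed. -/
theorem IsAlgClosed.of_denseRange_of_completeSpace {A L : Type*} [Field A]
    [NontriviallyNormedField L] [CompleteSpace L] [IsUltrametricDist L] [Algebra A L]
    (hi : DenseRange (algebraMap A L)) [IsAlgClosed A] : IsAlgClosed L := by
  apply IsAlgClosed.of_exists_root
  intro f fmon firr
  have hd : f.natDegree ≠ 0 := firr.natDegree_pos.ne'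
  let F := f.SplittingField
  let : NormedField F := spectralNorm.normedField L F
  let : NormedAlgebra L F := spectralNorm.normedAlgebra L F
  obtain ⟨a, ha⟩ := Splits.exists_eval_eq_zero (SplittingField.splits f)
    (by simpa using degree_ne_of_natDegree_ne hd)
  have fa0 : f.aeval a = 0 := by rwa [← eval_map_algebraMap]
  have hiso : Isometry (algebraMap L F) := algebraMap_isometry L F
  have hmem : a ∈ closure (Set.range (algebraMap L F)) := by
    refine Metric.mem_closure_iff.2 fun δ hδ => ?_
    have hε : (δ / (max ‖a‖ 1)) ^ f.natDegree / (f.natDegree + 1) > 0 := by positivity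
    obtain ⟨g, gmon, gdeg, gcoeff⟩ :=
      exists_monic_and_natDegree_eq_and_norm_map_algebraMap_coeff_sub_lt hi fmon hε
    obtain ⟨b, hb, hab⟩ := exists_aroots_norm_sub_lt_of_norm_coeff_sub_lt
      hε fa0 fmon (gmon.map _) (gdeg ▸ (g.natDegree_map _)) gcoeff
      (by simpa [Polynomial.map_map] using
        (IsAlgClosed.splits g).map ((algebraMap L F).comp (algebraMap A L)))
    rw [Polynomial.aroots_def, Splits.roots_map ((IsAlgClosed.splits g).map _),
      Multiset.mem_map] at hb
    obtain ⟨c, -, hc⟩ := hb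
    refine ⟨b, ⟨c, hc⟩, ?_⟩
    have h1 : ((f.natDegree : ℝ) + 1) *
        ((δ / (max ‖a‖ 1)) ^ f.natDegree / (f.natDegree + 1)) =
          (δ / (max ‖a‖ 1)) ^ f.natDegree := by
      field_simp
    rw [h1, Real.pow_rpow_inv_natCast (by positivity) hd,
      div_mul_cancel₀ _ (by positivity)] at hab
    rwa [dist_eq_norm]
  obtain ⟨c, hc⟩ := hiso.isClosedEmbedding.isClosed_range.closure_eq ▸ hmem
  refine ⟨c, (algebraMap L F).injective ?_⟩
  rwa [← Polynomial.aeval_algebraMap_apply_eq_algebraMap_eval, hc, map_zero]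

theorem norm_algebraMap_completedAlgClosure {K : Type*} [NontriviallyNormedField K]
    [IsUltrametricDist K] [CompleteSpace K] (x : K) :
    ‖algebraMap K (CompletedAlgClosure K) x‖ = ‖x‖ :=
  norm_algebraMap' (CompletedAlgClosure K) x

instance CompletedAlgClosure.instIsAlgClosed (K : Type*) [NontriviallyNormedField K]
    [IsUltrametricDist K] [CompleteSpace K] : IsAlgClosed (CompletedAlgClosure K) := by
  let : NontriviallyNormedField (CompletedAlgClosure K) :=
    { (inferInstance : NormedField (CompletedAlgClosure K)) with
      non_trivial := by
        obtain ⟨x, hx⟩ := NontriviallyNormedField.non_trivial (α := K)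
        exact ⟨algebraMap K (CompletedAlgClosure K) x, by
          rwa [norm_algebraMap_completedAlgClosure]⟩ }
  exact IsAlgClosed.of_denseRange_of_completeSpace (A := NormedAlgClosure K)
    (L := CompletedAlgClosure K) UniformSpace.Completion.denseRange_coe

section NonArchimedean

variable {L : Type*} [NormedField L] [IsUltrametricDist L]

/-! ### Ultrametric estimates -/

theorem ultra_norm_add_lt {x y : L} {r : ℝ} (hx : ‖x‖ < r) (hy : ‖y‖ < r) : ‖x + y‖ < r :=
  (IsUltrametricDist.norm_add_le_max x y).trans_lt (max_lt hx hy)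

theorem ultra_norm_sub_lt {x y : L} {r : ℝ} (hx : ‖x‖ < r) (hy : ‖y‖ < r) : ‖x - y‖ < r := by
  rw [sub_eq_add_neg]
  exact ultra_norm_add_lt hx (by rwa [norm_neg])

theorem ultra_norm_add_le {x y : L} {r : ℝ} (hx : ‖x‖ ≤ r) (hy : ‖y‖ ≤ r) : ‖x + y‖ ≤ r :=
  (IsUltrametricDist.norm_add_le_max x y).trans (max_le hx hy)

theorem ultra_norm_sub_le {x y : L} {r : ℝ} (hx : ‖x‖ ≤ r) (hy : ‖y‖ ≤ r) : ‖x - y‖ ≤ r := by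
  rw [sub_eq_add_neg]
  exact ultra_norm_add_le hx (by rwa [norm_neg])

theorem ultra_norm_sub_lt_trans {x y z : L} {r : ℝ} (h₁ : ‖x - y‖ < r) (h₂ : ‖y - z‖ < r) :
    ‖x - z‖ < r := by
  simpa using ultra_norm_add_lt h₁ h₂

theorem norm_eq_of_norm_sub_lt {x y : L} (h : ‖x - y‖ < ‖y‖) : ‖x‖ = ‖y‖ := by
  have := IsUltrametricDist.norm_add_eq_max_of_norm_ne_norm h.ne
  rwa [sub_add_cancel, max_eq_right h.le] at this

theorem mem_ringInt_iff {x : L} : x ∈ RingInt L ↔ ‖x‖ ≤ 1 := by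
  rw [Valuation.mem_valuationSubring_iff]
  rfl

theorem isUnit_ringInt_iff (x : RingInt L) : IsUnit x ↔ ‖(x : L)‖ = 1 := by
  refine ⟨fun h => ?_, fun h => ?_⟩
  · obtain ⟨y, hy⟩ := h.exists_right_inv
    have h1 := congrArg (fun z : RingInt L => ‖(z : L)‖) hy
    simp only [MulMemClass.coe_mul, norm_mul, OneMemClass.coe_one, norm_one] at h1
    refine (mem_ringInt_iff.1 x.2).antisymm ?_
    rw [← h1]
    exact mul_le_of_le_one_right (norm_nonneg _) (mem_ringInt_iff.1 y.2)
  · have h0 : (x : L) ≠ 0 := by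
      intro h0
      simp [h0] at h
    refine IsUnit.of_mul_eq_one ⟨(x : L)⁻¹, mem_ringInt_iff.2 (by simp [h])⟩ ?_
    exact Subtype.ext (mul_inv_cancel₀ h0)

theorem residue_eq_zero_iff_norm_lt_one (x : RingInt L) :
    IsLocalRing.residue (RingInt L) x = 0 ↔ ‖(x : L)‖ < 1 := by
  rw [IsLocalRing.residue_eq_zero_iff, IsLocalRing.mem_maximalIdeal, mem_nonunits_iff,
    isUnit_ringInt_iff, (mem_ringInt_iff.1 x.2).lt_iff_ne]

/-- If `P` is smaller at `a` than at some point of the closed disk of radius `1` about `a`, then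
`P` has a root in the open disk of radius `1` about `a`: otherwise each factor of `P` is at least
as large at `a` as at that point. -/
theorem exists_root_norm_sub_lt_one [IsAlgClosed L] (P : L[X]) {a u : L} (hu : ‖u - a‖ ≤ 1)
    (h : ‖P.eval a‖ < ‖P.eval u‖) : ∃ r, P.eval r = 0 ∧ ‖r - a‖ < 1 := by
  by_contra! hr
  refine h.not_ge ?_
  have hP := IsAlgClosed.splits P
  have key : ∀ s : Multiset L, (∀ r ∈ s, 1 ≤ ‖r - a‖) →
      ‖(s.map fun r => u - r).prod‖ ≤ ‖(s.map fun r => a - r).prod‖ := by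
    intro s
    induction s using Multiset.induction_on with
    | empty => simp
    | cons r s ih =>
      intro hs
      simp only [Multiset.map_cons, Multiset.prod_cons, norm_mul]
      have h1 := hs r (Multiset.mem_cons_self r s)
      rw [norm_sub_rev] at h1
      refine mul_le_mul ?_ (ih fun x hx => hs x (Multiset.mem_cons_of_mem hx))
        (norm_nonneg _) (norm_nonneg _)
      simpa using ultra_norm_add_le (hu.trans h1) (le_refl ‖a - r‖)
  rw [hP.eval_eq_prod_roots, hP.eval_eq_prod_roots, norm_mul, norm_mul]
  gcongr
  refine key _ fun r hr' => hr r ?_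
  exact (mem_roots'.1 hr').2

/-! ### The cyclotomic polynomial over a non-archimedean field -/

theorem norm_aeval_int_le_one (P : ℤ[X]) {x : L} (hx : ‖x‖ ≤ 1) : ‖aeval x P‖ ≤ 1 := by
  have := (aeval (⟨x, mem_ringInt_iff.2 hx⟩ : RingInt L) P).2
  rw [mem_ringInt_iff] at this
  have h2 := aeval_algebraMap_apply L (⟨x, mem_ringInt_iff.2 hx⟩ : RingInt L) P
  exact (congrArg norm h2).trans_le this

/-- The first-order Taylor expansion of an integral polynomial on the unit disk, with an integral
remainder. -/
theorem exists_aeval_add_eq (P : ℤ[X]) {x y : L} (hx : ‖x‖ ≤ 1) (hy : ‖y‖ ≤ 1) :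
    ∃ k : L, ‖k‖ ≤ 1 ∧
      aeval (x + y) P = aeval x P + aeval x (derivative P) * y + k * y ^ 2 := by
  let x' : RingInt L := ⟨x, mem_ringInt_iff.2 hx⟩
  let y' : RingInt L := ⟨y, mem_ringInt_iff.2 hy⟩
  obtain ⟨k, hk⟩ := binomExpansion (P.map (algebraMap ℤ (RingInt L))) x' y'
  refine ⟨k, mem_ringInt_iff.1 k.2, ?_⟩
  rw [derivative_map, eval_map_algebraMap, eval_map_algebraMap, eval_map_algebraMap] at hk
  have := congrArg (algebraMap (RingInt L) L) hk
  simp only [map_add, map_mul, map_pow, ← aeval_algebraMap_apply] at this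
  exact this

omit [IsUltrametricDist L] in
theorem eval_cyclotomic_eq_aeval (m : ℕ) (x : L) :
    (cyclotomic m L).eval x = aeval x (cyclotomic m ℤ) := by
  rw [← map_cyclotomic_int, eval_map, ← algebraMap_int_eq, aeval_def]

theorem norm_eval_cyclotomic_le_one (m : ℕ) {x : L} (hx : ‖x‖ ≤ 1) :
    ‖(cyclotomic m L).eval x‖ ≤ 1 := by
  rw [eval_cyclotomic_eq_aeval]
  exact norm_aeval_int_le_one _ hx

theorem norm_eval_cyclotomic_eq_one {m : ℕ} {x : L} (hx : ‖x‖ ≤ 1) (h : ‖x ^ m - 1‖ = 1) :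
    ‖(cyclotomic m L).eval x‖ = 1 := by
  obtain ⟨q, hq⟩ := cyclotomic.dvd_X_pow_sub_one m ℤ
  have h1 := congrArg (aeval x) hq
  simp only [map_sub, map_pow, aeval_X, map_one, map_mul, ← eval_cyclotomic_eq_aeval] at h1
  rw [h1, norm_mul] at h
  refine (norm_eval_cyclotomic_le_one m hx).antisymm ?_
  rw [← h]
  exact mul_le_of_le_one_right (norm_nonneg _) (norm_aeval_int_le_one q hx)

variable {m : ℕ} (hm2 : 2 ≤ m) (hm : ‖(m : L)‖ = 1)
include hm

/-- Where `Ψ_m` is small its derivative is a unit, since `X ^ m - 1` is separable. -/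
theorem norm_derivative_cyclotomic_eq_one {x : L} (hx : ‖x‖ = 1)
    (h : ‖(cyclotomic m L).eval x‖ < 1) : ‖aeval x (derivative (cyclotomic m ℤ))‖ = 1 := by
  obtain ⟨q, hq⟩ := cyclotomic.dvd_X_pow_sub_one m ℤ
  have h1 := congrArg (fun p => aeval x (derivative p)) hq
  simp only [derivative_sub, derivative_X_pow, derivative_one, derivative_mul, map_mul,
    map_add, map_natCast, map_pow, aeval_X, sub_zero,
    ← eval_cyclotomic_eq_aeval] at h1
  refine (norm_aeval_int_le_one _ hx.le).antisymm ?_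
  by_contra! hlt
  have h2 : ‖(m : L) * x ^ (m - 1)‖ = 1 := by simp [hm, hx]
  rw [h1] at h2
  refine (ultra_norm_add_lt ?_ ?_).ne h2 <;> rw [norm_mul]
  · exact mul_lt_one_of_nonneg_of_lt_one_left (norm_nonneg _) hlt (norm_aeval_int_le_one q hx.le)
  · exact mul_lt_one_of_nonneg_of_lt_one_left (norm_nonneg _) h (norm_aeval_int_le_one _ hx.le)

omit [IsUltrametricDist L] hm in
include hm2 in
theorem eval_zero_cyclotomic : (cyclotomic m L).eval 0 = 1 := by
  rw [← coeff_zero_eq_eval_zero, cyclotomic_coeff_zero _ hm2]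

include hm2 in
theorem norm_eval_one_cyclotomic : ‖(cyclotomic m L).eval 1‖ = 1 := by
  obtain ⟨q, hq⟩ := cyclotomic_dvd_geom_sum_of_dvd ℤ (dvd_refl m) (by omega)
  have h1 := congrArg (aeval (1 : L)) hq
  simp only [map_sum, map_pow, aeval_X, one_pow, Finset.sum_const, Finset.card_range,
    nsmul_eq_mul, mul_one, map_mul, ← eval_cyclotomic_eq_aeval] at h1
  rw [h1, norm_mul] at hm
  refine (norm_eval_cyclotomic_le_one m norm_one.le).antisymm ?_
  rw [← hm]
  exact mul_le_of_le_one_right (norm_nonneg _) (norm_aeval_int_le_one q norm_one.le)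

include hm2 in
theorem norm_sub_one_of_eval_cyclotomic_eq_zero {ζ : L} (hζ : ‖ζ‖ ≤ 1)
    (h : (cyclotomic m L).eval ζ = 0) : ‖ζ - 1‖ = 1 := by
  refine (ultra_norm_sub_le hζ norm_one.le).antisymm ?_
  by_contra! hlt
  obtain ⟨k, hk, he⟩ := exists_aeval_add_eq (cyclotomic m ℤ) (x := 1) norm_one.le hlt.le
  rw [add_sub_cancel, ← eval_cyclotomic_eq_aeval, ← eval_cyclotomic_eq_aeval, h] at he
  have h1 : (cyclotomic m L).eval 1 =
      -((aeval 1 (derivative (cyclotomic m ℤ)) + k * (ζ - 1)) * (ζ - 1)) := by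
    linear_combination -he
  have h2 := norm_eval_one_cyclotomic hm2 hm
  rw [h1, norm_neg, norm_mul] at h2
  refine (mul_lt_one_of_nonneg_of_lt_one_right ?_ (norm_nonneg _) hlt).ne h2
  refine ultra_norm_add_le (norm_aeval_int_le_one _ norm_one.le) ?_
  rw [norm_mul]
  exact mul_le_one₀ hk (norm_nonneg _) hlt.le

/-- On a residue class of units, `z ↦ z ^ m` is an isometry. -/
theorem norm_pow_sub_pow {x y : L} (hx : ‖x‖ = 1) (hxy : ‖y - x‖ < 1) :
    ‖y ^ m - x ^ m‖ = ‖y - x‖ := by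
  obtain ⟨k, hk, he⟩ := exists_aeval_add_eq (X ^ m : ℤ[X]) hx.le hxy.le
  simp only [add_sub_cancel, map_pow, aeval_X, derivative_X_pow, map_mul, map_natCast] at he
  have h1 : y ^ m - x ^ m = (m * x ^ (m - 1) + k * (y - x)) * (y - x) := by
    linear_combination he
  have h2 : ‖(m : L) * x ^ (m - 1)‖ = 1 := by simp [hm, hx]
  rw [h1, norm_mul, norm_eq_of_norm_sub_lt, h2, one_mul]
  rw [add_sub_cancel_left, h2, norm_mul]
  exact mul_lt_one_of_nonneg_of_lt_one_right hk (norm_nonneg _) hxy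

/-- On a residue class containing a root of `Ψ_m`, the polynomial `Ψ_m` is an isometry. -/
theorem norm_eval_cyclotomic_sub {x y : L} (hx : ‖x‖ = 1)
    (h : ‖(cyclotomic m L).eval x‖ < 1) (hxy : ‖y - x‖ < 1) :
    ‖(cyclotomic m L).eval y - (cyclotomic m L).eval x‖ = ‖y - x‖ := by
  obtain ⟨k, hk, he⟩ := exists_aeval_add_eq (cyclotomic m ℤ) hx.le hxy.le
  rw [add_sub_cancel, ← eval_cyclotomic_eq_aeval, ← eval_cyclotomic_eq_aeval] at he
  have h1 : (cyclotomic m L).eval y - (cyclotomic m L).eval x =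
      (aeval x (derivative (cyclotomic m ℤ)) + k * (y - x)) * (y - x) := by
    linear_combination he
  have h2 := norm_derivative_cyclotomic_eq_one hm hx h
  rw [h1, norm_mul, norm_eq_of_norm_sub_lt, h2, one_mul]
  rw [add_sub_cancel_left, h2, norm_mul]
  exact mul_lt_one_of_nonneg_of_lt_one_right hk (norm_nonneg _) hxy

omit hm in
/-- An integral polynomial does not increase distances in the unit disk. -/
theorem norm_aeval_sub_le (P : ℤ[X]) {x y : L} (hx : ‖x‖ ≤ 1) (hy : ‖y‖ ≤ 1) :
    ‖aeval x P - aeval y P‖ ≤ ‖x - y‖ := by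
  have hxy := ultra_norm_sub_le hx hy
  obtain ⟨k, hk, he⟩ := exists_aeval_add_eq P hy hxy
  rw [add_sub_cancel] at he
  have h1 : aeval x P - aeval y P = (aeval y (derivative P) + k * (x - y)) * (x - y) := by
    linear_combination he
  rw [h1, norm_mul]
  refine mul_le_of_le_one_left (norm_nonneg _)
    (ultra_norm_add_le (norm_aeval_int_le_one _ hy) ?_)
  rw [norm_mul]
  exact mul_le_one₀ hk (norm_nonneg _) hxy

end NonArchimedean

section NonArchimedean

variable {L : Type*} [NormedField L] [IsUltrametricDist L]

/-! ### Residue classes, disks and affinoids -/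

theorem red_coe_of_norm_le {x : L} (hx : ‖x‖ ≤ 1) :
    red (x : P1 L) = ((IsLocalRing.residue (RingInt L) ⟨x, mem_ringInt_iff.2 hx⟩ :
      ResField L) : P1 (ResField L)) :=
  dif_pos (mem_ringInt_iff.2 hx)

theorem red_coe_of_one_lt_norm {x : L} (hx : 1 < ‖x‖) : red (x : P1 L) = OnePoint.infty :=
  dif_neg (by rwa [mem_ringInt_iff, not_le])

theorem red_coe_ne_infty {x : L} (hx : ‖x‖ ≤ 1) : red (x : P1 L) ≠ OnePoint.infty := by
  rw [red_coe_of_norm_le hx]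
  exact OnePoint.coe_ne_infty _

theorem exists_coe_of_red_ne_infty {p : P1 L} (h : red p ≠ OnePoint.infty) :
    ∃ x : L, p = x ∧ ‖x‖ ≤ 1 := by
  induction p using OnePoint.rec with
  | infty => exact absurd rfl h
  | coe x => exact ⟨x, rfl, not_lt.1 fun hx => h (red_coe_of_one_lt_norm hx)⟩

theorem red_coe_eq_red_coe_iff {x y : L} (hx : ‖x‖ ≤ 1) (hy : ‖y‖ ≤ 1) :
    red (x : P1 L) = red (y : P1 L) ↔ ‖x - y‖ < 1 := by
  rw [red_coe_of_norm_le hx, red_coe_of_norm_le hy, OnePoint.coe_eq_coe, ← sub_eq_zero, ← map_sub,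
    residue_eq_zero_iff_norm_lt_one]
  rfl

omit [IsUltrametricDist L] in
theorem coe_mem_openDisk_iff {a x : L} {r : ℝ} : (x : P1 L) ∈ openDisk a r ↔ ‖x - a‖ < r :=
  OnePoint.coe_injective.mem_set_image

omit [IsUltrametricDist L] in
theorem coe_mem_closedDisk_iff {a x : L} {r : ℝ} : (x : P1 L) ∈ closedDisk a r ↔ ‖x - a‖ ≤ r :=
  OnePoint.coe_injective.mem_set_image

theorem residueClass_red_coe {a : L} (ha : ‖a‖ ≤ 1) :
    residueClass (red (a : P1 L)) = openDisk a 1 := by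
  ext p
  constructor
  · intro hp
    have hp' : red p = red (a : P1 L) := hp
    obtain ⟨x, rfl, hx⟩ := exists_coe_of_red_ne_infty (hp' ▸ red_coe_ne_infty ha)
    exact coe_mem_openDisk_iff.2 ((red_coe_eq_red_coe_iff hx ha).1 hp')
  · rintro ⟨x, hx, rfl⟩
    have hx' : ‖x - a‖ < 1 := hx
    refine (red_coe_eq_red_coe_iff ?_ ha).2 hx'
    simpa using ultra_norm_add_le hx'.le ha

/-- A set of points of `L` which, with two points, contains the closed disk about one of them
through the other, either lies in one residue class or contains the closed unit disk. -/
theorem subset_residueClass_or_of_ball {D : Set (P1 L)} {a : L}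
    (hD : ∀ p ∈ D, ∃ x : L, p = x ∧ ∀ z : L, ‖z - a‖ ≤ ‖x - a‖ → (z : P1 L) ∈ D) :
    (∃ c, D ⊆ residueClass c) ∨ ∃ c, (residueClass c)ᶜ ⊆ D := by
  by_cases h : D ⊆ residueClass (red (a : P1 L))
  · exact Or.inl ⟨_, h⟩
  obtain ⟨p, hpD, hp⟩ := Set.not_subset.1 h
  obtain ⟨x, rfl, hx⟩ := hD p hpD
  have hne : red (x : P1 L) ≠ red (a : P1 L) := hp
  have hmax : max 1 ‖a‖ ≤ ‖x - a‖ := by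
    by_cases ha : ‖a‖ ≤ 1
    · rw [max_eq_left ha]
      by_cases hx1 : ‖x‖ ≤ 1
      · rwa [Ne, red_coe_eq_red_coe_iff hx1 ha, not_lt] at hne
      · by_contra! hlt
        exact hx1 (by simpa using ultra_norm_add_le hlt.le ha)
    · rw [not_le] at ha
      rw [max_eq_right ha.le]
      by_contra! hlt
      refine hne ?_
      rw [red_coe_of_one_lt_norm ha, red_coe_of_one_lt_norm]
      rwa [norm_eq_of_norm_sub_lt hlt]
  refine Or.inr ⟨OnePoint.infty, fun q hq => ?_⟩
  obtain ⟨z, rfl, hz⟩ := exists_coe_of_red_ne_infty hq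
  exact hx z ((ultra_norm_sub_le (hz.trans (le_max_left _ _)) (le_max_right _ _)).trans hmax)

theorem IsDisk.subset_residueClass_or {D : Set (P1 L)} (hD : IsDisk D) :
    (∃ c, D ⊆ residueClass c) ∨ ∃ c, (residueClass c)ᶜ ⊆ D := by
  obtain ⟨a, r, -, hD⟩ := hD
  have hopen : ∀ p ∈ openDisk a r, ∃ x : L, p = x ∧
      ∀ z : L, ‖z - a‖ ≤ ‖x - a‖ → (z : P1 L) ∈ openDisk a r := by
    rintro _ ⟨x, hx, rfl⟩
    exact ⟨x, rfl, fun z hz => coe_mem_openDisk_iff.2 (hz.trans_lt hx)⟩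
  have hclosed : ∀ p ∈ closedDisk a r, ∃ x : L, p = x ∧
      ∀ z : L, ‖z - a‖ ≤ ‖x - a‖ → (z : P1 L) ∈ closedDisk a r := by
    rintro _ ⟨x, hx, rfl⟩
    exact ⟨x, rfl, fun z hz => coe_mem_closedDisk_iff.2 (hz.trans hx)⟩
  have hcompl : ((∃ c, Dᶜ ⊆ residueClass c) ∨ ∃ c, (residueClass c)ᶜ ⊆ Dᶜ) →
      (∃ c, D ⊆ residueClass c) ∨ ∃ c, (residueClass c)ᶜ ⊆ D := by
    rintro (⟨c, hc⟩ | ⟨c, hc⟩)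
    · exact Or.inr ⟨c, Set.compl_subset_comm.1 hc⟩
    · exact Or.inl ⟨c, Set.compl_subset_compl.1 hc⟩
  rcases hD with rfl | rfl | hD | hD
  · exact subset_residueClass_or_of_ball hopen
  · exact subset_residueClass_or_of_ball hclosed
  · exact hcompl (hD ▸ subset_residueClass_or_of_ball hopen)
  · exact hcompl (hD ▸ subset_residueClass_or_of_ball hclosed)

theorem IsDisk.subset_residueClass_or_finite {W : Set (P1 L)} (hW : IsDisk W) :
    (∃ c, W ⊆ residueClass c) ∨ {c | ¬ residueClass c ⊆ W}.Finite := by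
  refine hW.subset_residueClass_or.imp_right ?_
  rintro ⟨c, hc⟩
  refine (Set.finite_singleton c).subset fun d hd => ?_
  obtain ⟨p, hp, hpW⟩ := Set.not_subset.1 hd
  have h1 : red p = c := by
    by_contra h
    exact hpW (hc h)
  have h2 : red p = d := hp
  exact h2.symm.trans h1

/-- A connected affinoid either lies in one residue class or contains all but finitely many
residue classes: a removed disk that is not contained in one residue class has its complement in
one residue class. -/
theorem IsConnectedAffinoid.subset_residueClass_or_finite {W : Set (P1 L)}
    (hW : IsConnectedAffinoid W) :
    (∃ c, W ⊆ residueClass c) ∨ {c | ¬ residueClass c ⊆ W}.Finite := by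
  obtain ⟨N, U, hU, -, rfl⟩ := hW
  by_cases h : ∃ i c, (residueClass c)ᶜ ⊆ U i
  · obtain ⟨i, c, hc⟩ := h
    refine Or.inl ⟨c, Set.compl_subset_comm.1 (hc.trans (Set.subset_iUnion U i))⟩
  · have hs : ∀ i, ∃ c, U i ⊆ residueClass c := fun i =>
      (hU i).subset_residueClass_or.resolve_right fun ⟨c, hc⟩ => h ⟨i, c, hc⟩
    choose c hc using hs
    refine Or.inr ((Set.finite_range c).subset fun d hd => ?_)
    obtain ⟨p, hp, hpW⟩ := Set.not_subset.1 hd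
    rw [Set.notMem_compl_iff, Set.mem_iUnion] at hpW
    obtain ⟨i, hi⟩ := hpW
    have h1 : red p = c i := hc i hi
    have h2 : red p = d := hp
    exact ⟨i, h1.symm.trans h2⟩

omit [IsUltrametricDist L] in
theorem InValueGroup.pos {r : ℝ} (h : InValueGroup L r) : 0 < r := by
  obtain ⟨c, hc, rfl⟩ := h
  exact norm_pos_iff.2 hc

omit [IsUltrametricDist L] in
theorem IsRationalOpenDisk.isDisk {W : Set (P1 L)} (hW : IsRationalOpenDisk W) : IsDisk W := by
  obtain ⟨a, r, hr, h⟩ := hW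
  exact ⟨a, r, hr.pos, by tauto⟩

omit [IsUltrametricDist L] in
theorem IsRationalClosedDisk.isDisk {W : Set (P1 L)} (hW : IsRationalClosedDisk W) :
    IsDisk W := by
  obtain ⟨a, r, hr, h⟩ := hW
  exact ⟨a, r, hr.pos, by tauto⟩

omit [IsUltrametricDist L] in
theorem IsRationalOpenConnectedAffinoid.isConnectedAffinoid {W : Set (P1 L)}
    (hW : IsRationalOpenConnectedAffinoid W) : IsConnectedAffinoid W := by
  obtain ⟨N, U, hU, h⟩ := hW
  exact ⟨N, U, fun i => (hU i).isDisk, h⟩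

theorem IsComponentPiece.subset_residueClass_or_finite {φ : RatFunc L} {t : CompType}
    {W : Set (P1 L)} (hW : IsComponentPiece φ t W) :
    (∃ c, W ⊆ residueClass c) ∨ {c | ¬ residueClass c ⊆ W}.Finite := by
  cases t with
  | analytic => exact hW.1.subset_residueClass_or_finite
  | disk => exact hW.1.subset_residueClass_or_finite
  | dynamical => exact hW.1.isConnectedAffinoid.subset_residueClass_or_finite
  | dynamicalDisk => exact hW.1.isDisk.subset_residueClass_or_finite

omit [IsUltrametricDist L] in
theorem isRationalOpenDisk_openDisk_one (a : L) : IsRationalOpenDisk (openDisk a 1) :=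
  ⟨a, 1, ⟨1, one_ne_zero, norm_one⟩, Or.inl rfl⟩

omit [IsUltrametricDist L] in
theorem isRationalOpenConnectedAffinoid_openDisk_one (a : L) :
    IsRationalOpenConnectedAffinoid (openDisk a 1) := by
  refine ⟨1, fun _ => (openDisk a 1)ᶜ,
    fun _ => ⟨a, 1, ⟨1, one_ne_zero, norm_one⟩, Or.inr (compl_compl _)⟩,
    fun i j hij => absurd (Subsingleton.elim i j) hij, ?_⟩
  rw [Set.iUnion_const, compl_compl]

/-! ### The spherical metric on the unit disk -/

omit [IsUltrametricDist L] in
theorem sphericalDist_coe_coe {x y : L} (hx : ‖x‖ ≤ 1) (hy : ‖y‖ ≤ 1) :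
    sphericalDist (x : P1 L) (y : P1 L) = ‖x - y‖ := by
  change ‖x - y‖ / (max 1 ‖x‖ * max 1 ‖y‖) = _
  rw [max_eq_left hx, max_eq_left hy, mul_one, div_one]

theorem exists_coe_of_sphericalDist_lt {x : L} (hx : ‖x‖ ≤ 1) {p : P1 L} {s : ℝ} (hs : s ≤ 1)
    (h : sphericalDist (x : P1 L) p < s) : ∃ y : L, p = y ∧ ‖y‖ ≤ 1 ∧ ‖y - x‖ < s := by
  induction p using OnePoint.rec with
  | infty =>
    change 1 / max 1 ‖x‖ < s at h
    rw [max_eq_left hx, div_one] at h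
    exact absurd hs h.not_ge
  | coe y =>
    have hy : ‖y‖ ≤ 1 := by
      by_contra! hy
      change ‖x - y‖ / (max 1 ‖x‖ * max 1 ‖y‖) < s at h
      have h1 : ‖x - y‖ = ‖y‖ := by
        rw [norm_sub_rev]
        have := norm_eq_of_norm_sub_lt (x := y - x) (y := y) (by
          rw [sub_sub_cancel_left, norm_neg]
          exact hx.trans_lt hy)
        exact this
      rw [max_eq_left hx, max_eq_right hy.le, one_mul, h1, div_self (by linarith)] at h
      exact hs.not_gt h
    rw [sphericalDist_coe_coe hx hy, norm_sub_rev] at h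
    exact ⟨y, rfl, hy, h⟩

end NonArchimedean

/-! ### Rational functions in lowest terms -/

theorem RatFunc.num_denom_of_isCoprime {L : Type*} [Field L] {p q : L[X]} (hq : q.Monic)
    (h : IsCoprime p q) :
    RatFunc.num (algebraMap L[X] (RatFunc L) p / algebraMap L[X] (RatFunc L) q) = p ∧
      RatFunc.denom (algebraMap L[X] (RatFunc L) p / algebraMap L[X] (RatFunc L) q) = q := by
  set φ := algebraMap L[X] (RatFunc L) p / algebraMap L[X] (RatFunc L) q with hφ
  have h1 : φ.num * q = p * φ.denom := by
    apply RatFunc.algebraMap_injective L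
    have h2 := RatFunc.num_div_denom φ
    nth_rw 3 [hφ] at h2
    rw [div_eq_div_iff (RatFunc.algebraMap_ne_zero φ.denom_ne_zero)
      (RatFunc.algebraMap_ne_zero hq.ne_zero)] at h2
    rwa [map_mul, map_mul]
  have h3 : φ.denom = q := by
    refine eq_of_monic_of_associated φ.monic_denom hq (associated_of_dvd_dvd
      (RatFunc.denom_div_dvd p q) (h.symm.dvd_of_dvd_mul_left ⟨φ.num, ?_⟩))
    rw [← h1, mul_comm]
  refine ⟨?_, h3⟩
  rw [h3] at h1
  exact mul_right_cancel₀ hq.ne_zero h1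

theorem ratBaseChange_div {K L : Type*} [Field K] [Field L] [Algebra K L] (p : K[X]) {q : K[X]}
    (hq : q ≠ 0) :
    ratBaseChange K L (algebraMap K[X] (RatFunc K) p / algebraMap K[X] (RatFunc K) q) =
      algebraMap L[X] (RatFunc L) (p.map (algebraMap K L)) /
        algebraMap L[X] (RatFunc L) (q.map (algebraMap K L)) := by
  set φ := algebraMap K[X] (RatFunc K) p / algebraMap K[X] (RatFunc K) q with hφ
  have h1 : φ.num * q = p * φ.denom := by
    apply RatFunc.algebraMap_injective K
    have h2 := RatFunc.num_div_denom φ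
    nth_rw 3 [hφ] at h2
    rw [div_eq_div_iff (RatFunc.algebraMap_ne_zero φ.denom_ne_zero)
      (RatFunc.algebraMap_ne_zero hq)] at h2
    rwa [map_mul, map_mul]
  have hinj := (algebraMap K L).injective
  rw [ratBaseChange, div_eq_div_iff, ← map_mul, ← map_mul, ← Polynomial.map_mul,
    ← Polynomial.map_mul, h1]
  · exact RatFunc.algebraMap_ne_zero ((Polynomial.map_ne_zero_iff hinj).2 φ.denom_ne_zero)
  · exact RatFunc.algebraMap_ne_zero ((Polynomial.map_ne_zero_iff hinj).2 hq)

/-! ### The map `z ^ m + T / Ψ_m(z)` on residue classes -/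

/-- The rational function `z ^ m + T / Ψ_m(z)`, as a quotient of polynomials in lowest terms. -/
noncomputable def cyclotomicMap {L : Type*} [Field L] (m : ℕ) (T : L) : RatFunc L :=
  algebraMap L[X] (RatFunc L) (X ^ m * cyclotomic m L + C T) /
    algebraMap L[X] (RatFunc L) (cyclotomic m L)

theorem exampleMap_eq_cyclotomicMap {K : Type*} [NontriviallyNormedField K] (m : ℕ) (T : K) :
    exampleMap m T = cyclotomicMap m T := by
  have h := RatFunc.algebraMap_ne_zero (cyclotomic_ne_zero m K)
  rw [exampleMap, cyclotomicMap, eq_div_iff h, add_mul, div_mul_cancel₀ _ h]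
  simp

theorem ratBaseChange_cyclotomicMap {K L : Type*} [Field K] [Field L] [Algebra K L] (m : ℕ)
    (T : K) : ratBaseChange K L (cyclotomicMap m T) = cyclotomicMap m (algebraMap K L T) := by
  rw [cyclotomicMap, ratBaseChange_div _ (cyclotomic_ne_zero m K), cyclotomicMap]
  simp

/-- The value `x ^ m + T / Ψ_m(x)` in the affine line; it has its junk value `x ^ m` at the
poles. -/
noncomputable def cyclotomicVal {L : Type*} [Field L] (m : ℕ) (T : L) (x : L) : L :=
  x ^ m + T / (cyclotomic m L).eval x

theorem num_denom_cyclotomicMap {L : Type*} [Field L] (m : ℕ) {T : L} (hT : T ≠ 0) :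
    (cyclotomicMap m T).num = X ^ m * cyclotomic m L + C T ∧
      (cyclotomicMap m T).denom = cyclotomic m L := by
  refine RatFunc.num_denom_of_isCoprime (cyclotomic.monic m L) ?_
  rw [add_comm, IsCoprime.add_mul_right_left_iff]
  obtain ⟨c, hc⟩ := (isUnit_C.2 hT.isUnit : IsUnit (C T)).exists_left_inv
  exact ⟨c, 0, by rw [hc, zero_mul, add_zero]⟩

open Classical in
theorem ratAct_cyclotomicMap_coe {L : Type*} [Field L] (m : ℕ) {T : L} (hT : T ≠ 0) {x : L}
    (hx : (cyclotomic m L).eval x ≠ 0) :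
    ratAct (cyclotomicMap m T) (x : P1 L) = ((cyclotomicVal m T x : L) : P1 L) := by
  obtain ⟨h1, h2⟩ := num_denom_cyclotomicMap m hT
  change (if _ then _ else _) = _
  rw [h1, h2, if_neg hx, cyclotomicVal]
  congr 1
  simp only [eval_add, eval_mul, eval_pow, eval_X, eval_C]
  field_simp

open Classical in
theorem ratAct_cyclotomicMap_of_eval_eq_zero {L : Type*} [Field L] (m : ℕ) {T : L} (hT : T ≠ 0)
    {x : L} (hx : (cyclotomic m L).eval x = 0) :
    ratAct (cyclotomicMap m T) (x : P1 L) = OnePoint.infty := by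
  obtain ⟨h1, h2⟩ := num_denom_cyclotomicMap m hT
  change (if _ then _ else _) = _
  rw [h2, if_pos hx]

section NonArchimedean

variable {L : Type*} [NormedField L] [IsUltrametricDist L]

theorem norm_pow_sub_pow_lt_one {x y : L} (k : ℕ) (hx : ‖x‖ ≤ 1) (hy : ‖y‖ ≤ 1)
    (h : ‖x - y‖ < 1) : ‖x ^ k - y ^ k‖ < 1 := by
  simpa using (norm_aeval_sub_le (X ^ k : ℤ[X]) hx hy).trans_lt h

theorem norm_add_eq_left_of_norm_lt {x y : L} (h : ‖y‖ < ‖x‖) : ‖x + y‖ = ‖x‖ :=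
  norm_eq_of_norm_sub_lt (by rwa [add_sub_cancel_left])

theorem norm_sub_eq_of_norm_sub_lt {x y z : L} (h : ‖x - y‖ < ‖y - z‖) : ‖x - z‖ = ‖y - z‖ :=
  norm_eq_of_norm_sub_lt (by rwa [sub_sub_sub_cancel_right])

/-- The residue class of `a` consists of units and contains no `m`-th root of unity, hence no
pole of `z ^ m + T / Ψ_m(z)`. -/
def AvoidsRootsOfUnity (m : ℕ) (a : L) : Prop := ‖a‖ = 1 ∧ ‖a ^ m - 1‖ = 1

/-- The residue classes of `a, a ^ m, …, a ^ (m ^ (n - 1))` avoid the `m`-th roots of unity, so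
that the first `n` iterates of `z ^ m + T / Ψ_m(z)` map the residue class of `a` into the residue
classes of the powers of `a`. -/
def AvoidsRootsOfUnityUpTo (m n : ℕ) (a : L) : Prop :=
  ∀ j < n, AvoidsRootsOfUnity m (a ^ m ^ j)

variable {m : ℕ}

theorem AvoidsRootsOfUnity.congr {a x : L} (ha : AvoidsRootsOfUnity m a) (hx : ‖x - a‖ < 1) :
    AvoidsRootsOfUnity m x := by
  have hx1 : ‖x‖ = 1 := by rw [norm_eq_of_norm_sub_lt (hx.trans_eq ha.1.symm), ha.1]
  refine ⟨hx1, ?_⟩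
  rw [norm_sub_eq_of_norm_sub_lt (y := a ^ m), ha.2]
  rw [ha.2]
  exact norm_pow_sub_pow_lt_one m hx1.le ha.1.le hx

theorem AvoidsRootsOfUnity.norm_eval {a : L} (ha : AvoidsRootsOfUnity m a) :
    ‖(cyclotomic m L).eval a‖ = 1 :=
  norm_eval_cyclotomic_eq_one ha.1.le ha.2

omit [IsUltrametricDist L] in
theorem AvoidsRootsOfUnityUpTo.head {n : ℕ} {a : L} (ha : AvoidsRootsOfUnityUpTo m (n + 1) a) :
    AvoidsRootsOfUnity m a := by
  simpa using ha 0 n.succ_pos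

omit [IsUltrametricDist L] in
theorem AvoidsRootsOfUnityUpTo.tail {n : ℕ} {a : L} (ha : AvoidsRootsOfUnityUpTo m (n + 1) a) :
    AvoidsRootsOfUnityUpTo m n (a ^ m) := by
  intro j hj
  have := ha (j + 1) (by omega)
  rwa [← pow_mul, ← pow_succ']

variable {T : L}

theorem AvoidsRootsOfUnity.ratAct {a : L} (ha : AvoidsRootsOfUnity m a) (hT0 : T ≠ 0) :
    ratAct (cyclotomicMap m T) (a : P1 L) = ((cyclotomicVal m T a : L) : P1 L) := by
  refine ratAct_cyclotomicMap_coe m hT0 (norm_pos_iff.1 ?_)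
  rw [ha.norm_eval]
  exact one_pos

theorem norm_cyclotomicVal_sub_pow_lt {a x : L} (ha : AvoidsRootsOfUnity m a) (hT1 : ‖T‖ < 1)
    (hx : ‖x - a‖ < 1) : ‖cyclotomicVal m T x - a ^ m‖ < 1 := by
  have hx' := ha.congr hx
  refine ultra_norm_sub_lt_trans (y := x ^ m) ?_
    (norm_pow_sub_pow_lt_one m hx'.1.le ha.1.le hx)
  rwa [cyclotomicVal, add_sub_cancel_left, norm_div, hx'.norm_eval, div_one]

omit [IsUltrametricDist L] in
/-- The difference of two values, separated into the contributions of `z ^ m` and of the pole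
part. -/
theorem cyclotomicVal_sub {x y : L} (hx : (cyclotomic m L).eval x ≠ 0)
    (hy : (cyclotomic m L).eval y ≠ 0) :
    cyclotomicVal m T y - cyclotomicVal m T x = (y ^ m - x ^ m) -
      T * ((cyclotomic m L).eval y - (cyclotomic m L).eval x) /
        ((cyclotomic m L).eval x * (cyclotomic m L).eval y) := by
  rw [cyclotomicVal, cyclotomicVal]
  field_simp
  ring

theorem norm_cyclotomicVal_sub (hm : ‖(m : L)‖ = 1) {x y : L} (hx : AvoidsRootsOfUnity m x)
    (hT1 : ‖T‖ < 1) (hxy : ‖y - x‖ < 1) :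
    ‖cyclotomicVal m T y - cyclotomicVal m T x‖ = ‖y - x‖ := by
  have hy := hx.congr hxy
  have hx0 := hx.norm_eval
  have hy0 := hy.norm_eval
  rcases eq_or_ne y x with rfl | hne
  · simp
  have hpos : 0 < ‖y - x‖ := norm_pos_iff.2 (sub_ne_zero.2 hne)
  rw [cyclotomicVal_sub (norm_pos_iff.1 (by rw [hx0]; exact one_pos))
    (norm_pos_iff.1 (by rw [hy0]; exact one_pos))]
  have hpow := norm_pow_sub_pow hm hx.1 hxy
  rw [norm_eq_of_norm_sub_lt (y := y ^ m - x ^ m) ?_, hpow]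
  rw [sub_sub_cancel_left, norm_neg, hpow, norm_div, norm_mul, norm_mul, hx0, hy0, mul_one, div_one,
    eval_cyclotomic_eq_aeval, eval_cyclotomic_eq_aeval]
  calc ‖T‖ * _ ≤ ‖T‖ * ‖y - x‖ := by
        gcongr
        exact norm_aeval_sub_le _ hy.1.le hx.1.le
    _ < ‖y - x‖ := mul_lt_of_lt_one_left hpos hT1

omit [IsUltrametricDist L] in
theorem eval_pow_sub_mul_cyclotomic (c x : L) :
    ((X ^ m - C c) * cyclotomic m L + C T).eval x =
      (x ^ m - c) * (cyclotomic m L).eval x + T := by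
  simp

omit [IsUltrametricDist L] in
theorem cyclotomicVal_eq_of_root {c x : L} (hT0 : T ≠ 0)
    (h : (x ^ m - c) * (cyclotomic m L).eval x + T = 0) :
    (cyclotomic m L).eval x ≠ 0 ∧ cyclotomicVal m T x = c := by
  have h0 : (cyclotomic m L).eval x ≠ 0 := by
    intro h0
    rw [h0, mul_zero, zero_add] at h
    exact hT0 h
  refine ⟨h0, ?_⟩
  rw [cyclotomicVal]
  field_simp
  linear_combination h

theorem exists_cyclotomicVal_eq [IsAlgClosed L] (hm2 : 2 ≤ m) (hT0 : T ≠ 0) (hT1 : ‖T‖ < 1)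
    {a c : L} (ha : AvoidsRootsOfUnity m a) (hc : ‖c - a ^ m‖ < 1) :
    ∃ x, ‖x - a‖ < 1 ∧ cyclotomicVal m T x = c := by
  have hc1 : ‖c‖ = 1 := by
    have h1 : ‖a ^ m‖ = 1 := by rw [norm_pow, ha.1, one_pow]
    rw [norm_eq_of_norm_sub_lt (hc.trans_eq h1.symm), h1]
  obtain ⟨x, hx, hxa⟩ := exists_root_norm_sub_lt_one ((X ^ m - C c) * cyclotomic m L + C T)
    (a := a) (u := 0) (by rw [zero_sub, norm_neg, ha.1]) (by
      rw [eval_pow_sub_mul_cyclotomic, eval_pow_sub_mul_cyclotomic, eval_zero_cyclotomic hm2,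
        zero_pow (by omega), zero_sub, mul_one]
      have h2 : ‖-c + T‖ = 1 := by
        rw [norm_add_eq_left_of_norm_lt (by rwa [norm_neg, hc1]), norm_neg, hc1]
      rw [h2]
      refine ultra_norm_add_lt ?_ hT1
      rwa [norm_mul, ha.norm_eval, mul_one, norm_sub_rev])
  rw [eval_pow_sub_mul_cyclotomic] at hx
  exact ⟨x, hxa, (cyclotomicVal_eq_of_root hT0 hx).2⟩

/-- The residue class of a primitive `m`-th root of unity is mapped onto the projective line. -/
theorem exists_ratAct_eq [IsAlgClosed L] (hm2 : 2 ≤ m) (hm : ‖(m : L)‖ = 1) (hT0 : T ≠ 0)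
    (hT1 : ‖T‖ < 1) {ζ : L} (hζ1 : ‖ζ‖ = 1) (hζ : (cyclotomic m L).eval ζ = 0) (p : P1 L) :
    ∃ x : L, ‖x - ζ‖ < 1 ∧ ratAct (cyclotomicMap m T) (x : P1 L) = p := by
  induction p using OnePoint.rec with
  | infty => exact ⟨ζ, by simp, ratAct_cyclotomicMap_of_eval_eq_zero m hT0 hζ⟩
  | coe c =>
    have hu : ∃ u : L, ‖u - ζ‖ ≤ 1 ∧
        ‖T‖ < ‖(u ^ m - c) * (cyclotomic m L).eval u + T‖ := by
      rcases lt_or_ge ‖c‖ 1 with hc | hc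
      · refine ⟨1, ultra_norm_sub_le norm_one.le hζ1.le, ?_⟩
        have h1 : ‖(1 : L) - c‖ = 1 := by
          rw [norm_eq_of_norm_sub_lt (y := 1), norm_one]
          rwa [sub_sub_cancel_left, norm_neg, norm_one]
        have h2 : ‖((1 : L) ^ m - c) * (cyclotomic m L).eval 1‖ = 1 := by
          rw [one_pow, norm_mul, norm_eval_one_cyclotomic hm2 hm, h1, mul_one]
        rwa [norm_add_eq_left_of_norm_lt (by rwa [h2]), h2]
      · refine ⟨0, by rw [zero_sub, norm_neg, hζ1], ?_⟩
        rw [eval_zero_cyclotomic hm2, zero_pow (by omega), zero_sub, mul_one,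
          norm_add_eq_left_of_norm_lt (by rw [norm_neg]; exact hT1.trans_le hc), norm_neg]
        exact hT1.trans_le hc
    obtain ⟨u, hu1, hu2⟩ := hu
    obtain ⟨x, hx, hxζ⟩ := exists_root_norm_sub_lt_one ((X ^ m - C c) * cyclotomic m L + C T)
      (a := ζ) (u := u) hu1 (by
        rw [eval_pow_sub_mul_cyclotomic, eval_pow_sub_mul_cyclotomic, hζ, mul_zero, zero_add]
        exact hu2)
    rw [eval_pow_sub_mul_cyclotomic] at hx
    obtain ⟨h0, h1⟩ := cyclotomicVal_eq_of_root hT0 hx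
    exact ⟨x, hxζ, by rw [ratAct_cyclotomicMap_coe m hT0 h0, h1]⟩

/-! ### Iteration along residue classes avoiding the poles -/

theorem iterate_on_residueClass (hm : ‖(m : L)‖ = 1) (hT0 : T ≠ 0) (hT1 : ‖T‖ < 1) {n : ℕ} {a : L}
    (ha : AvoidsRootsOfUnityUpTo m n a) {x : L} (hx : ‖x - a‖ < 1) :
    (ratAct (cyclotomicMap m T))^[n] (x : P1 L) = (((cyclotomicVal m T)^[n] x : L) : P1 L) ∧
    ‖(cyclotomicVal m T)^[n] x - a ^ m ^ n‖ < 1 ∧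
    ∀ y, ‖y - a‖ < 1 →
      ‖(cyclotomicVal m T)^[n] y - (cyclotomicVal m T)^[n] x‖ = ‖y - x‖ := by
  induction n generalizing a x with
  | zero => simpa using hx
  | succ n ih =>
    obtain ⟨h1, h2, h3⟩ := ih ha.tail (norm_cyclotomicVal_sub_pow_lt ha.head hT1 hx)
    have hx' := ha.head.congr hx
    simp only [Function.iterate_succ, Function.comp_apply]
    refine ⟨by rw [hx'.ratAct hT0, h1], by rwa [pow_succ' m, pow_mul], fun y hy => ?_⟩
    rw [h3 _ (norm_cyclotomicVal_sub_pow_lt ha.head hT1 hy)]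
    exact norm_cyclotomicVal_sub hm hx' hT1
      (ultra_norm_sub_lt_trans hy (by rwa [norm_sub_rev]))

theorem exists_iterate_cyclotomicVal_eq [IsAlgClosed L] (hm2 : 2 ≤ m) (hT0 : T ≠ 0) (hT1 : ‖T‖ < 1)
    {n : ℕ} {a c : L} (ha : AvoidsRootsOfUnityUpTo m n a) (hc : ‖c - a ^ m ^ n‖ < 1) :
    ∃ x, ‖x - a‖ < 1 ∧ (cyclotomicVal m T)^[n] x = c := by
  induction n generalizing a with
  | zero => exact ⟨c, by simpa using hc, rfl⟩
  | succ n ih =>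
    obtain ⟨y, hy, hyc⟩ := ih ha.tail (by rwa [← pow_mul, ← pow_succ'])
    obtain ⟨x, hx, hxy⟩ := exists_cyclotomicVal_eq hm2 hT0 hT1 ha.head hy
    exact ⟨x, hx, by rw [Function.iterate_succ_apply, hxy, hyc]⟩

/-! ### Julia points: the preimages of a repelling fixed point -/

/-- The residue class of a primitive `m`-th root of unity contains a repelling fixed point `r`.
At `r` one has `Ψ_m(r) = T / (r - r ^ m)`, of absolute value `|T|`, so the pole part has multiplier
of absolute value `1 / |T|` there. The point `u` certifies that `(X ^ m - X) * Ψ_m + T` is larger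
than `|T|` somewhere on the unit disk, which yields the root `r` near `ζ`. -/
theorem exists_repelling_fixedPoint [IsAlgClosed L] (hm2 : 2 ≤ m) (hm : ‖(m : L)‖ = 1)
    (hT0 : T ≠ 0) (hT1 : ‖T‖ < 1) {ζ : L} (hζ1 : ‖ζ‖ = 1) (hζ : (cyclotomic m L).eval ζ = 0)
    {u : L} (hu : AvoidsRootsOfUnity m u) (hu' : ‖u ^ m - u‖ = 1) :
    ∃ r, ‖r - ζ‖ < 1 ∧ ‖r‖ = 1 ∧ ratAct (cyclotomicMap m T) (r : P1 L) = (r : P1 L) ∧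
      ∀ z, ‖z - r‖ < ‖T‖ →
        ratAct (cyclotomicMap m T) (z : P1 L) = ((cyclotomicVal m T z : L) : P1 L) ∧
        ‖cyclotomicVal m T z - r‖ = ‖z - r‖ / ‖T‖ := by
  have hTpos : 0 < ‖T‖ := norm_pos_iff.2 hT0
  have heval : ∀ x : L, ((X ^ m - X) * cyclotomic m L + C T).eval x =
      (x ^ m - x) * (cyclotomic m L).eval x + T := fun x => by simp
  obtain ⟨r, hr, hrζ⟩ := exists_root_norm_sub_lt_one ((X ^ m - X) * cyclotomic m L + C T)
    (a := ζ) (u := u) (ultra_norm_sub_le hu.1.le hζ1.le) (by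
      rw [heval, heval, hζ, mul_zero, zero_add]
      have h1 : ‖(u ^ m - u) * (cyclotomic m L).eval u‖ = 1 := by
        rw [norm_mul, hu', hu.norm_eval, mul_one]
      rwa [norm_add_eq_left_of_norm_lt (by rwa [h1]), h1])
  rw [heval] at hr
  have hr1 : ‖r‖ = 1 := by rw [norm_eq_of_norm_sub_lt (hrζ.trans_eq hζ1.symm), hζ1]
  obtain ⟨hr0, hrr⟩ := cyclotomicVal_eq_of_root hT0 hr
  have hζm : ζ ^ m = 1 := by
    obtain ⟨q, hq⟩ := cyclotomic.dvd_X_pow_sub_one m L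
    have := congrArg (eval ζ) hq
    rw [eval_mul, hζ, zero_mul] at this
    simpa [sub_eq_zero] using this
  have hrm : ‖r ^ m - r‖ = 1 := by
    have h1 : ‖(1 : L) - ζ‖ = 1 := by
      rw [norm_sub_rev]
      exact norm_sub_one_of_eval_cyclotomic_eq_zero hm2 hm hζ1.le hζ
    have h2 := norm_pow_sub_pow_lt_one m hr1.le hζ1.le hrζ
    rw [hζm] at h2
    have h3 : r ^ m - r - (1 - ζ) = (r ^ m - 1) - (r - ζ) := by ring
    rw [norm_eq_of_norm_sub_lt (y := 1 - ζ), h1]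
    rw [h1, h3]
    exact ultra_norm_sub_lt h2 hrζ
  have hrΨ : ‖(cyclotomic m L).eval r‖ = ‖T‖ := by
    have h1 : (r ^ m - r) * (cyclotomic m L).eval r = -T := by linear_combination hr
    have h2 := congrArg norm h1
    rwa [norm_mul, hrm, one_mul, norm_neg] at h2
  refine ⟨r, hrζ, hr1, by rw [ratAct_cyclotomicMap_coe m hT0 hr0, hrr], fun z hz => ?_⟩
  have hz1 := hz.trans hT1
  have hsub := norm_eval_cyclotomic_sub hm hr1 (by rwa [hrΨ]) hz1
  have hzΨ : ‖(cyclotomic m L).eval z‖ = ‖T‖ := by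
    rw [norm_eq_of_norm_sub_lt (y := (cyclotomic m L).eval r), hrΨ]
    rwa [hsub, hrΨ]
  have hz0 : (cyclotomic m L).eval z ≠ 0 := norm_pos_iff.1 (by rwa [hzΨ])
  refine ⟨ratAct_cyclotomicMap_coe m hT0 hz0, ?_⟩
  rcases eq_or_ne z r with rfl | hne
  · simp [hrr]
  have hpos : 0 < ‖z - r‖ := norm_pos_iff.2 (sub_ne_zero.2 hne)
  have hpole : ‖T * ((cyclotomic m L).eval z - (cyclotomic m L).eval r) /
      ((cyclotomic m L).eval r * (cyclotomic m L).eval z)‖ = ‖z - r‖ / ‖T‖ := by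
    rw [norm_div, norm_mul, norm_mul, hrΨ, hzΨ, hsub, mul_div_mul_left _ _ hTpos.ne']
  nth_rw 1 [← hrr]
  rw [cyclotomicVal_sub hr0 hz0, ← norm_neg, neg_sub, norm_eq_of_norm_sub_lt, hpole]
  rw [sub_sub_cancel_left, norm_neg, hpole, norm_pow_sub_pow hm hr1 hz1]
  exact (lt_div_iff₀ hTpos).2 (mul_lt_of_lt_one_right hpos hT1)

theorem mem_juliaSet_of_iterate_eq (hm : ‖(m : L)‖ = 1) (hT0 : T ≠ 0) (hT1 : ‖T‖ < 1)
    {r : L} (hr1 : ‖r‖ = 1) (hfix : ratAct (cyclotomicMap m T) (r : P1 L) = (r : P1 L))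
    (hrep : ∀ z, ‖z - r‖ < ‖T‖ →
        ratAct (cyclotomicMap m T) (z : P1 L) = ((cyclotomicVal m T z : L) : P1 L) ∧
        ‖cyclotomicVal m T z - r‖ = ‖z - r‖ / ‖T‖)
    {n : ℕ} {a : L} (ha1 : ‖a‖ = 1) (ha : AvoidsRootsOfUnityUpTo m n a) {x : L} (hx : ‖x - a‖ < 1)
    (hxr : (cyclotomicVal m T)^[n] x = r) : (x : P1 L) ∈ juliaSet (cyclotomicMap m T) := by
  have hTpos : 0 < ‖T‖ := norm_pos_iff.2 hT0
  rintro ⟨s, hs, h⟩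
  have hx1 : ‖x‖ = 1 := by rw [norm_eq_of_norm_sub_lt (hx.trans_eq ha1.symm), ha1]
  obtain ⟨δ, hδ, hδ'⟩ := h x (by rwa [sphericalDist_coe_coe hx1.le hx1.le, sub_self, norm_zero])
    ‖T‖ hTpos
  -- A power of `T` provides a nonzero displacement smaller than `δ` and `1`.
  obtain ⟨k, hk⟩ := exists_pow_lt_of_lt_one (lt_min hδ one_pos) hT1
  set y := x + T ^ k with hy
  have hyx : ‖y - x‖ = ‖T‖ ^ k := by rw [hy, add_sub_cancel_left, norm_pow]
  have hya : ‖y - a‖ < 1 :=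
    ultra_norm_sub_lt_trans (by rw [hyx]; exact hk.trans_le (min_le_right _ _)) hx
  have hy1 : ‖y‖ = 1 := by rw [norm_eq_of_norm_sub_lt (hya.trans_eq ha1.symm), ha1]
  have hclose := hδ' y (by
    rw [sphericalDist_coe_coe hx1.le hy1.le, norm_sub_rev, hyx]
    exact hk.trans_le (min_le_left _ _))
  obtain ⟨hix, -, hiso⟩ := iterate_on_residueClass hm hT0 hT1 ha hx
  obtain ⟨hiy, -, -⟩ := iterate_on_residueClass hm hT0 hT1 ha hya
  have hd := hiso y hya
  rw [hxr, hyx] at hd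
  -- The orbit of `y` moves away from the fixed point `r` by the factor `1 / |T|` at each step.
  have key : ∀ j : ℕ, ∃ z : L, (ratAct (cyclotomicMap m T))^[j + n] (y : P1 L) = z ∧
      ‖z - r‖ = ‖T‖ ^ k / ‖T‖ ^ j ∧ ‖z - r‖ < ‖T‖ := by
    intro j
    have hxj : (ratAct (cyclotomicMap m T))^[j + n] (x : P1 L) = r := by
      rw [Function.iterate_add_apply, hix, hxr]
      exact Function.iterate_fixed hfix j
    have hj := hclose (j + n)
    rw [hxj] at hj
    obtain ⟨z, hz, -, hzr⟩ := exists_coe_of_sphericalDist_lt hr1.le hT1.le hj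
    refine ⟨z, hz, ?_, hzr⟩
    clear hzr hj hxj
    induction j generalizing z with
    | zero =>
      rw [zero_add, hiy, OnePoint.coe_eq_coe] at hz
      rw [← hz, hd, pow_zero, div_one]
    | succ j ih =>
      have hxj : (ratAct (cyclotomicMap m T))^[j + n] (x : P1 L) = r := by
        rw [Function.iterate_add_apply, hix, hxr]
        exact Function.iterate_fixed hfix j
      have hj := hclose (j + n)
      rw [hxj] at hj
      obtain ⟨w, hw, -, hwr⟩ := exists_coe_of_sphericalDist_lt hr1.le hT1.le hj
      rw [add_right_comm, Function.iterate_succ_apply', hw, (hrep w hwr).1,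
        OnePoint.coe_eq_coe] at hz
      rw [← hz, (hrep w hwr).2, ih w hw, div_div, ← pow_succ]
  obtain ⟨z, -, h1, h2⟩ := key k
  rw [h1, div_self (pow_pos hTpos k).ne'] at h2
  exact hT1.not_gt h2

end NonArchimedean

section NonArchimedean

variable {L : Type*} [NormedField L] [IsUltrametricDist L] {m : ℕ} {T : L}

omit [IsUltrametricDist L] in
theorem exists_norm_eq_one_eval_cyclotomic_eq_zero [IsAlgClosed L] (hm2 : 2 ≤ m) :
    ∃ ζ : L, ‖ζ‖ = 1 ∧ ζ ^ m = 1 ∧ (cyclotomic m L).eval ζ = 0 := by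
  have hdeg : (cyclotomic m L).degree ≠ 0 := by
    have : 0 < m.totient := Nat.totient_pos.2 (by omega)
    rw [degree_cyclotomic]
    exact_mod_cast this.ne'
  obtain ⟨ζ, hζ⟩ := IsAlgClosed.exists_root (cyclotomic m L) hdeg
  have hζm : ζ ^ m = 1 := by
    obtain ⟨q, hq⟩ := cyclotomic.dvd_X_pow_sub_one m L
    have := congrArg (eval ζ) hq
    rw [eval_mul, IsRoot.def.1 hζ, zero_mul] at this
    simpa [sub_eq_zero] using this
  refine ⟨ζ, ?_, hζm, hζ⟩
  have h1 := congrArg norm hζm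
  rw [norm_pow, norm_one] at h1
  exact (pow_eq_one_iff_of_nonneg (norm_nonneg _) (by omega)).1 h1

/-- The reductions of the iterated `m`-th power roots `η` of a primitive `m`-th root of unity `ζ`
give infinitely many residue classes; the class of a solution of `η ^ (m ^ n) = ζ` meets the Julia
set and is mapped onto the projective line by the `(n + 1)`-st iterate. -/
theorem exists_residueClass_seq [IsAlgClosed L] (hm2 : 2 ≤ m) (hm : ‖(m : L)‖ = 1)
    (hT0 : T ≠ 0) (hT1 : ‖T‖ < 1)
    {u : L} (hu : AvoidsRootsOfUnity m u) (hu' : ‖u ^ m - u‖ = 1) :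
    ∃ c : ℕ → P1 (ResField L), Function.Injective c ∧
      (∀ n, (juliaSet (cyclotomicMap m T) ∩ residueClass (c n)).Nonempty) ∧
      ∀ n, (ratAct (cyclotomicMap m T))^[n + 1] '' residueClass (c n) = Set.univ := by
  obtain ⟨ζ, hζ1, hζm, hζ⟩ := exists_norm_eq_one_eval_cyclotomic_eq_zero (L := L) hm2
  have hζ' := norm_sub_one_of_eval_cyclotomic_eq_zero hm2 hm hζ1.le hζ
  have hex : ∀ n : ℕ, ∃ η : L, η ^ m ^ n = ζ := fun n =>
    IsAlgClosed.exists_pow_nat_eq ζ (pow_pos (by omega) n)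
  choose η hη using hex
  have hη1 : ∀ n, ‖η n‖ = 1 := fun n => by
    have h1 := congrArg norm (hη n)
    rw [norm_pow, hζ1] at h1
    exact (pow_eq_one_iff_of_nonneg (norm_nonneg _) (pow_pos (by omega : 0 < m) n).ne').1 h1
  -- If a power of `η n` before `ζ` reduced to `1`, then so would `ζ`.
  have hne : ∀ n j, j ≤ n → ‖η n ^ m ^ j - 1‖ = 1 := fun n j hj => by
    have hp : ‖η n ^ m ^ j‖ ≤ 1 := by rw [norm_pow, hη1, one_pow]
    refine (ultra_norm_sub_le hp norm_one.le).antisymm ?_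
    by_contra! hlt
    have h1 := norm_pow_sub_pow_lt_one (m ^ (n - j)) hp norm_one.le hlt
    rw [← pow_mul, ← pow_add, Nat.add_sub_cancel' hj, hη, one_pow, hζ'] at h1
    exact h1.false
  have havoid : ∀ n, AvoidsRootsOfUnityUpTo m n (η n) := fun n j hj =>
    ⟨by rw [norm_pow, hη1, one_pow], by rw [← pow_mul, ← pow_succ]; exact hne n (j + 1) hj⟩
  have hclass : ∀ {n : ℕ} {x : L}, ‖x - η n‖ < 1 → (x : P1 L) ∈ residueClass (red (η n : P1 L)) :=
    fun {n x} hx => by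
      rw [residueClass_red_coe (hη1 n).le]
      exact coe_mem_openDisk_iff.2 hx
  have hdistinct : ∀ n n', n < n' → red (η n : P1 L) ≠ red (η n' : P1 L) := by
    intro n n' hlt heq
    rw [red_coe_eq_red_coe_iff (hη1 n).le (hη1 n').le, norm_sub_rev] at heq
    have h1 := norm_pow_sub_pow_lt_one (m ^ (n + 1)) (hη1 n').le (hη1 n).le heq
    rw [pow_succ m n, pow_mul (η n), hη, hζm, ← pow_succ, hne n' (n + 1) hlt] at h1
    exact h1.false
  obtain ⟨r, hrζ, hr1, hfix, hrep⟩ :=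
    exists_repelling_fixedPoint hm2 hm hT0 hT1 hζ1 hζ hu hu'
  refine ⟨fun n => red (η n : P1 L), fun n n' h => ?_, fun n => ?_, fun n => ?_⟩
  · by_contra hnn
    rcases lt_or_gt_of_ne hnn with hlt | hlt
    · exact hdistinct n n' hlt h
    · exact hdistinct n' n hlt h.symm
  · obtain ⟨x, hx, hxr⟩ := exists_iterate_cyclotomicVal_eq (c := r) hm2 hT0 hT1 (havoid n)
      (by rwa [hη])
    exact ⟨x, mem_juliaSet_of_iterate_eq hm hT0 hT1 hr1 hfix hrep (hη1 n) (havoid n) hx hxr,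
      hclass hx⟩
  · refine Set.eq_univ_of_forall fun p => ?_
    obtain ⟨z, hz, hzp⟩ := exists_ratAct_eq hm2 hm hT0 hT1 hζ1 hζ p
    obtain ⟨x, hx, hxz⟩ := exists_iterate_cyclotomicVal_eq (c := z) hm2 hT0 hT1 (havoid n)
      (by rwa [hη])
    refine ⟨x, hclass hx, ?_⟩
    rw [Function.iterate_succ_apply', (iterate_on_residueClass hm hT0 hT1 (havoid n) hx).1, hxz,
      hzp]

theorem IsComponentPiece.exists_subset_residueClass [IsAlgClosed L] (hm2 : 2 ≤ m)
    (hm : ‖(m : L)‖ = 1) (hT0 : T ≠ 0) (hT1 : ‖T‖ < 1)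
    {u : L} (hu : AvoidsRootsOfUnity m u) (hu' : ‖u ^ m - u‖ = 1) {t : CompType}
    {W : Set (P1 L)} (hW : IsComponentPiece (cyclotomicMap m T) t W) :
    ∃ c, W ⊆ residueClass c := by
  refine hW.subset_residueClass_or_finite.resolve_right fun hfin => ?_
  obtain ⟨c, hc, hJ, hsurj⟩ := exists_residueClass_seq hm2 hm hT0 hT1 hu hu'
  obtain ⟨n, hn⟩ : ∃ n, residueClass (c n) ⊆ W := by
    by_contra! h
    exact Set.infinite_of_injective_forall_mem hc h hfin
  have hfatou : ¬ W ⊆ fatouSet (cyclotomicMap m T) := fun h => by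
    obtain ⟨x, hxJ, hx⟩ := hJ n
    exact hxJ (h (hn hx))
  have hdyn : ¬ (⋃ k : ℕ, (ratAct (cyclotomicMap m T))^[k] '' W)ᶜ.Infinite := fun h => by
    have h1 : (⋃ k : ℕ, (ratAct (cyclotomicMap m T))^[k] '' W) = Set.univ := by
      refine Set.eq_univ_of_univ_subset ?_
      rw [← hsurj n]
      exact (Set.image_mono hn).trans
        (Set.subset_iUnion (fun k => (ratAct (cyclotomicMap m T))^[k] '' W) (n + 1))
    rw [h1, Set.compl_univ] at h
    exact h Set.finite_empty
  cases t with
  | analytic => exact hfatou hW.2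
  | disk => exact hfatou hW.2
  | dynamical => exact hdyn hW.2
  | dynamicalDisk => exact hdyn hW.2

/-! ### Wandering components -/

/-- The reduction of `b` is nonzero and not a root of unity. -/
def ResiduallyNontorsion (b : L) : Prop := ‖b‖ = 1 ∧ ∀ n, 0 < n → ‖b ^ n - 1‖ = 1

variable {b : L}

omit [IsUltrametricDist L] in
theorem ResiduallyNontorsion.norm_pow_sub_pow (hb : ResiduallyNontorsion b) {i j : ℕ}
    (hij : i ≠ j) : ‖b ^ i - b ^ j‖ = 1 := by
  wlog h : j < i generalizing i j
  · rw [norm_sub_rev]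
    exact this hij.symm (by omega)
  obtain ⟨k, rfl⟩ := Nat.exists_eq_add_of_lt h
  have h1 : b ^ (j + k + 1) - b ^ j = b ^ j * (b ^ (k + 1) - 1) := by ring
  rw [h1, norm_mul, norm_pow, hb.1, one_pow, one_mul, hb.2 _ k.succ_pos]

omit [IsUltrametricDist L] in
theorem ResiduallyNontorsion.pow (hb : ResiduallyNontorsion b) {k : ℕ} (hk : 0 < k) :
    ResiduallyNontorsion (b ^ k) :=
  ⟨by rw [norm_pow, hb.1, one_pow], fun n hn => by rw [← pow_mul]; exact hb.2 _ (by positivity)⟩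

omit [IsUltrametricDist L] in
theorem ResiduallyNontorsion.avoidsRootsOfUnityUpTo (hb : ResiduallyNontorsion b) (hm2 : 2 ≤ m)
    (n : ℕ) : AvoidsRootsOfUnityUpTo m n b := fun j _ =>
  have h := hb.pow (pow_pos (by omega : 0 < m) j)
  ⟨h.1, h.2 m (by omega)⟩

theorem ResiduallyNontorsion.openDisk_subset_fatouSet (hb : ResiduallyNontorsion b) (hm2 : 2 ≤ m)
    (hm : ‖(m : L)‖ = 1) (hT0 : T ≠ 0) (hT1 : ‖T‖ < 1) :
    openDisk b 1 ⊆ fatouSet (cyclotomicMap m T) := by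
  have hnorm : ∀ {k : ℕ} {x : L}, ‖x - b ^ k‖ < 1 → ‖x‖ ≤ 1 := fun {k x} hx => by
    have h1 : ‖b ^ k‖ = 1 := by rw [norm_pow, hb.1, one_pow]
    rw [norm_eq_of_norm_sub_lt (hx.trans_eq h1.symm), h1]
  rintro _ ⟨x, hx, rfl⟩
  have hx : ‖x - b‖ < 1 := hx
  refine ⟨1, one_pos, fun p hp => ?_⟩
  obtain ⟨y, rfl, hy1, hyx⟩ :=
    exists_coe_of_sphericalDist_lt (hnorm (k := 1) (by rwa [pow_one])) le_rfl hp
  have hyb := ultra_norm_sub_lt_trans hyx hx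
  refine fun ε hε => ⟨min ε 1, lt_min hε one_pos, fun q hq n => ?_⟩
  obtain ⟨z, rfl, hz1, hzy⟩ := exists_coe_of_sphericalDist_lt hy1 (min_le_right ε 1) hq
  have hzb := ultra_norm_sub_lt_trans (hzy.trans_le (min_le_right _ _)) hyb
  have ha := hb.avoidsRootsOfUnityUpTo hm2 n
  obtain ⟨hy2, hy3, hy4⟩ := iterate_on_residueClass hm hT0 hT1 ha hyb
  obtain ⟨hz2, hz3, -⟩ := iterate_on_residueClass hm hT0 hT1 ha hzb
  rw [hy2, hz2, sphericalDist_coe_coe (hnorm hy3) (hnorm hz3), norm_sub_rev, hy4 z hzb]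
  exact hzy.trans_le (min_le_left _ _)

theorem ResiduallyNontorsion.isComponentPiece (hb : ResiduallyNontorsion b) (hm2 : 2 ≤ m)
    (hm : ‖(m : L)‖ = 1) (hT0 : T ≠ 0) (hT1 : ‖T‖ < 1) (t : CompType) :
    IsComponentPiece (cyclotomicMap m T) t (openDisk b 1) := by
  have hfatou := hb.openDisk_subset_fatouSet hm2 hm hT0 hT1
  -- The orbit of the disk stays in the unit disk, so it misses all `T ^ (-(k + 1))`.
  have hdyn : (⋃ n : ℕ, (ratAct (cyclotomicMap m T))^[n] '' openDisk b 1)ᶜ.Infinite := by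
    have hTpos : 0 < ‖T‖ := norm_pos_iff.2 hT0
    refine Set.infinite_of_injective_forall_mem
      (f := fun k : ℕ => (((T ^ (k + 1))⁻¹ : L) : P1 L)) (fun k l hkl => ?_) fun k hk => ?_
    · have h1 := congrArg norm (inv_injective (OnePoint.coe_injective hkl))
      rw [norm_pow, norm_pow] at h1
      have := pow_right_injective₀ hTpos hT1.ne h1
      omega
    · obtain ⟨n, _, ⟨x, hx, rfl⟩, hxk⟩ := Set.mem_iUnion.1 hk
      have hx : ‖x - b‖ < 1 := hx
      obtain ⟨h1, h2, -⟩ :=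
        iterate_on_residueClass hm hT0 hT1 (hb.avoidsRootsOfUnityUpTo hm2 n) hx
      rw [h1, OnePoint.coe_eq_coe] at hxk
      have h3 : ‖b ^ m ^ n‖ = 1 := by rw [norm_pow, hb.1, one_pow]
      have h4 := norm_eq_of_norm_sub_lt (h2.trans_eq h3.symm)
      rw [h3, hxk, norm_inv, norm_pow, inv_eq_one] at h4
      exact (pow_lt_one₀ hTpos.le hT1 k.succ_ne_zero).ne h4
  have hdisk := isRationalOpenDisk_openDisk_one b
  have haff := isRationalOpenConnectedAffinoid_openDisk_one b
  cases t with
  | analytic => exact ⟨haff.isConnectedAffinoid, hfatou⟩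
  | disk => exact ⟨hdisk.isDisk, hfatou⟩
  | dynamical => exact ⟨haff, hdyn⟩
  | dynamicalDisk => exact ⟨hdisk, hdyn⟩

section Components

variable [IsAlgClosed L] (hm2 : 2 ≤ m) (hm : ‖(m : L)‖ = 1) (hT0 : T ≠ 0) (hT1 : ‖T‖ < 1)
  (hb : ResiduallyNontorsion b) (t : CompType)

include hm2 hm hT0 hT1 hb

theorem IsComponentPiece.subset_openDisk {t : CompType} {W : Set (P1 L)}
    (hW : IsComponentPiece (cyclotomicMap m T) t W) {p : P1 L} (hpW : p ∈ W)
    (hp : p ∈ openDisk b 1) : W ⊆ openDisk b 1 := by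
  have hu' : ‖b ^ m - b‖ = 1 := by
    simpa using hb.norm_pow_sub_pow (i := m) (j := 1) (by omega)
  obtain ⟨c, hc⟩ := hW.exists_subset_residueClass hm2 hm hT0 hT1 ⟨hb.1, hb.2 m (by omega)⟩ hu'
  rw [← residueClass_red_coe hb.1.le] at hp ⊢
  have h1 : red p = c := hc hpW
  have h2 : red p = red (b : P1 L) := hp
  rwa [← h2, h1]

theorem componentAt_eq_openDisk {p : P1 L} (hp : p ∈ openDisk b 1) :
    componentAt (cyclotomicMap m T) t p = openDisk b 1 := by
  refine subset_antisymm (Set.sUnion_subset fun W hW => ?_) (Set.subset_sUnion_of_mem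
    ⟨hp, hb.isComponentPiece hm2 hm hT0 hT1 t⟩)
  exact hW.2.subset_openDisk hm2 hm hT0 hT1 hb hW.1 hp

theorem isFatouComponent_openDisk :
    IsFatouComponent (cyclotomicMap m T) t (openDisk b 1) := by
  have hmem : (b : P1 L) ∈ openDisk b 1 := coe_mem_openDisk_iff.2 (by simp)
  exact ⟨b, hb.openDisk_subset_fatouSet hm2 hm hT0 hT1 hmem, hmem,
    (componentAt_eq_openDisk hm2 hm hT0 hT1 hb t hmem).symm⟩

theorem componentMap_openDisk :
    componentMap (cyclotomicMap m T) t (openDisk b 1) = openDisk (b ^ m) 1 := by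
  have hbm := hb.pow (by omega : 0 < m)
  have himage : ratAct (cyclotomicMap m T) '' openDisk b 1 ⊆ openDisk (b ^ m) 1 := by
    rintro _ ⟨_, ⟨x, hx, rfl⟩, rfl⟩
    have hx : ‖x - b‖ < 1 := hx
    obtain ⟨h1, h2, -⟩ :=
      iterate_on_residueClass hm hT0 hT1 (hb.avoidsRootsOfUnityUpTo hm2 1) hx
    rw [Function.iterate_one] at h1
    rw [h1]
    exact coe_mem_openDisk_iff.2 (by simpa using h2)
  refine subset_antisymm (Set.sUnion_subset ?_) (Set.subset_sUnion_of_mem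
    ⟨isFatouComponent_openDisk hm2 hm hT0 hT1 hbm t, himage⟩)
  rintro V ⟨⟨y, -, -, rfl⟩, hV⟩
  have hq : ratAct (cyclotomicMap m T) (b : P1 L) ∈ ratAct (cyclotomicMap m T) '' openDisk b 1 :=
    Set.mem_image_of_mem _ (coe_mem_openDisk_iff.2 (by simp))
  obtain ⟨W, ⟨hyW, hW⟩, hqW⟩ := hV hq
  have hy := hW.subset_openDisk hm2 hm hT0 hT1 hbm hqW (himage hq) hyW
  exact (componentAt_eq_openDisk hm2 hm hT0 hT1 hbm t hy).subset

theorem iterate_componentMap_openDisk (n : ℕ) :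
    (componentMap (cyclotomicMap m T) t)^[n] (openDisk b 1) = openDisk (b ^ m ^ n) 1 := by
  induction n with
  | zero => simp
  | succ n ih =>
    rw [Function.iterate_succ_apply', ih, componentMap_openDisk hm2 hm hT0 hT1
      (hb.pow (pow_pos (by omega : 0 < m) n)) t, ← pow_mul, ← pow_succ]

omit [IsUltrametricDist L] [IsAlgClosed L] hm2 hm hT0 hT1 in
theorem ResiduallyNontorsion.eq_of_openDisk_eq {i j : ℕ}
    (h : openDisk (b ^ i) 1 = openDisk (b ^ j) 1) : i = j := by
  by_contra hij
  have h1 : ((b ^ i : L) : P1 L) ∈ openDisk (b ^ j) 1 := by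
    rw [← h]
    exact coe_mem_openDisk_iff.2 (by simp)
  exact (coe_mem_openDisk_iff.1 h1).ne (hb.norm_pow_sub_pow hij)

theorem isWanderingComponent_openDisk :
    IsWanderingComponent (cyclotomicMap m T) t (openDisk b 1) := by
  refine ⟨isFatouComponent_openDisk hm2 hm hT0 hT1 hb t, ?_⟩
  rintro ⟨n, k, hk, hper⟩
  have h1 := hper.eq
  rw [← Function.iterate_add_apply, iterate_componentMap_openDisk hm2 hm hT0 hT1 hb,
    iterate_componentMap_openDisk hm2 hm hT0 hT1 hb] at h1
  have := Nat.pow_right_injective hm2 (hb.eq_of_openDisk_eq h1)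
  omega

/-- The disks of radius `1` about the powers `b ^ (1 + m * n)` lie in distinct grand orbits: the
exponents are prime to `m`, and so no two of them differ by a factor that is a quotient of powers
of `m`. -/
theorem infinite_wanderingGrandOrbits :
    (wanderingGrandOrbits (cyclotomicMap m T) t).Infinite := by
  have hpow : ∀ n : ℕ, ResiduallyNontorsion (b ^ (1 + m * n)) := fun n => hb.pow (by omega)
  refine Set.infinite_of_injective_forall_mem
    (f := fun n : ℕ => componentGrandOrbit (cyclotomicMap m T) t (openDisk (b ^ (1 + m * n)) 1))
    (fun n n' h => ?_)
    fun n => ⟨_, isWanderingComponent_openDisk hm2 hm hT0 hT1 (hpow n) t, rfl⟩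
  have hmem : openDisk (b ^ (1 + m * n)) 1 ∈
      componentGrandOrbit (cyclotomicMap m T) t (openDisk (b ^ (1 + m * n)) 1) :=
    ⟨isFatouComponent_openDisk hm2 hm hT0 hT1 (hpow n) t, 0, 0, rfl⟩
  have h' : componentGrandOrbit (cyclotomicMap m T) t (openDisk (b ^ (1 + m * n)) 1) =
    componentGrandOrbit (cyclotomicMap m T) t (openDisk (b ^ (1 + m * n')) 1) := h
  rw [h'] at hmem
  obtain ⟨-, i, j, hij⟩ := hmem
  rw [iterate_componentMap_openDisk hm2 hm hT0 hT1 (hpow n'),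
    iterate_componentMap_openDisk hm2 hm hT0 hT1 (hpow n), ← pow_mul, ← pow_mul] at hij
  have hexp := hb.eq_of_openDisk_eq hij
  have hcop : ∀ n i : ℕ, Nat.Coprime (m ^ i) (1 + m * n) := fun n i =>
    Nat.Coprime.pow_left i (by simp)
  have h1 : m ^ i ∣ m ^ j := (hcop n i).dvd_of_dvd_mul_left (hexp ▸ dvd_mul_left _ _)
  have h2 : m ^ j ∣ m ^ i := (hcop n' j).dvd_of_dvd_mul_left (hexp ▸ dvd_mul_left _ _)
  rw [Nat.dvd_antisymm h1 h2] at hexp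
  have h3 := Nat.eq_of_mul_eq_mul_right (pow_pos (by omega : 0 < m) j) hexp
  exact (Nat.eq_of_mul_eq_mul_left (by omega : 0 < m) (by omega)).symm

end Components

/-! ### The reduction of the map -/

theorem hasNontrivialReduction_cyclotomicMap (hm2 : 2 ≤ m) (hT1 : ‖T‖ < 1) :
    HasNontrivialReduction (cyclotomicMap m T) (RatFunc.X ^ m) := by
  classical
  set T' : RingInt L := ⟨T, mem_ringInt_iff.2 hT1.le⟩ with hT'
  have hT0 : IsLocalRing.residue (RingInt L) T' = 0 := (residue_eq_zero_iff_norm_lt_one T').2 hT1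
  refine ⟨X ^ m * cyclotomic m (RingInt L) + C T', cyclotomic m (RingInt L),
    cyclotomic_ne_zero m _, ?_, ⟨(cyclotomic m (RingInt L)).natDegree, Or.inr ?_⟩,
    _, _, _, _, _, rfl, rfl, rfl, rfl, rfl, ?_⟩
  · rw [cyclotomicMap]
    simp [hT']
  · rw [coeff_natDegree, (cyclotomic.monic m _).leadingCoeff]
    simp
  rw [Polynomial.map_add, Polynomial.map_mul, Polynomial.map_pow, map_X, map_C, hT0, C_0, add_zero,
    map_cyclotomic]
  set Ψ := cyclotomic m (ResField L)
  set h := EuclideanDomain.gcd (X ^ m * Ψ) Ψ with hh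
  have hΨ : Ψ ≠ 0 := cyclotomic_ne_zero m _
  have hdvd : h ∣ Ψ := EuclideanDomain.gcd_dvd_right _ _
  have hne : h ≠ 0 := fun h0 => hΨ (by rwa [h0, zero_dvd_iff] at hdvd)
  have hg : h * (Ψ / h) = Ψ := EuclideanDomain.mul_div_cancel' hne hdvd
  have hf : X ^ m * Ψ / h = X ^ m * (Ψ / h) := EuclideanDomain.mul_div_assoc _ hdvd
  have hg0 : Ψ / h ≠ 0 := fun h0 => hΨ (by rw [← hg, h0, mul_zero])
  refine ⟨fun h0 => ?_, ?_⟩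
  · have h1 := h0.1
    rw [hf, natDegree_mul (pow_ne_zero _ X_ne_zero) hg0, natDegree_X_pow] at h1
    omega
  · rw [hf, map_mul, mul_div_cancel_right₀ _ (RatFunc.algebraMap_ne_zero hg0), map_pow,
      RatFunc.algebraMap_X]

end NonArchimedean

theorem ratDegree_X_pow (k : Type*) [Field k] (m : ℕ) :
    ratDegree (RatFunc.X ^ m : RatFunc k) = m := by
  have h : (RatFunc.X ^ m : RatFunc k) = algebraMap k[X] (RatFunc k) (X ^ m) := by
    rw [map_pow, RatFunc.algebraMap_X]
  rw [ratDegree, h, RatFunc.num_algebraMap, RatFunc.denom_algebraMap]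
  simp

/-! ### Elements of the residue field that are not torsion -/

/-- A field all of whose nonzero elements are roots of unity is algebraic over its finite prime
field. -/
theorem exists_forall_pow_ne_one {k : Type*} [Field k] (hk : ¬ IsAlgebraicOverFiniteField k) :
    ∃ x : k, x ≠ 0 ∧ ∀ n, 0 < n → x ^ n ≠ 1 := by
  by_contra! h
  apply hk
  obtain ⟨p, hp⟩ := CharP.exists k
  have hp0 : p ≠ 0 := by
    rintro rfl
    have : CharZero k := CharP.charP_to_charZero k
    obtain ⟨n, hn, h2⟩ := h 2 two_ne_zero
    have h3 : (2 : ℕ) ^ n = 1 := by exact_mod_cast h2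
    exact (Nat.one_lt_two_pow hn.ne').ne' h3
  have : Fact p.Prime := ⟨(CharP.char_is_prime_or_zero k p).resolve_right hp0⟩
  refine ⟨(ZMod.castHom dvd_rfl k : ZMod p →+* k).fieldRange, ?_, ⟨fun x => ?_⟩⟩
  · exact Set.finite_range (ZMod.castHom dvd_rfl k : ZMod p →+* k)
  · by_cases hx : x = 0
    · rw [hx]
      exact isAlgebraic_zero
    obtain ⟨n, hn, hxn⟩ := h x hx
    exact ⟨X ^ n - 1, X_pow_sub_C_ne_zero hn 1, by simp [hxn]⟩

theorem ne_zero_and_forall_pow_ne_one_of_infinite_range_zpow {k : Type*} [Field k] {x : k}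
    (h : (Set.range fun n : ℤ => x ^ n).Infinite) : x ≠ 0 ∧ ∀ n, 0 < n → x ^ n ≠ 1 := by
  refine ⟨?_, fun n hn hx => h ?_⟩
  · rintro rfl
    refine h ((Set.toFinite {0, 1}).subset ?_)
    rintro _ ⟨n, rfl⟩
    rcases eq_or_ne n 0 with rfl | hn
    · simp
    · simp [zero_zpow n hn]
  · have hx0 : x ≠ 0 := by
      rintro rfl
      simp [hn.ne'] at hx
    refine ((Set.finite_Ico (0 : ℤ) n).image fun z : ℤ => x ^ z).subset ?_
    rintro _ ⟨z, rfl⟩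
    have hn' : (n : ℤ) ≠ 0 := by exact_mod_cast hn.ne'
    refine ⟨z % n, ⟨Int.emod_nonneg _ hn', Int.emod_lt_of_pos _ (by omega)⟩, ?_⟩
    change x ^ (z % n) = x ^ z
    conv_rhs => rw [← Int.emod_add_mul_ediv z n, zpow_add₀ hx0, zpow_mul, zpow_natCast, hx,
      one_zpow, mul_one]

section Main

variable {K : Type*} [NontriviallyNormedField K] [IsUltrametricDist K]

theorem norm_eq_one_of_residue_ne_zero {x : RingInt K}
    (hx : IsLocalRing.residue (RingInt K) x ≠ 0) : ‖(x : K)‖ = 1 :=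
  (mem_ringInt_iff.1 x.2).antisymm
    (not_lt.1 fun h => hx ((residue_eq_zero_iff_norm_lt_one x).2 h))

variable [CompleteSpace K]

theorem residuallyNontorsion_algebraMap {x : RingInt K}
    (hx0 : IsLocalRing.residue (RingInt K) x ≠ 0)
    (hx : ∀ n, 0 < n → IsLocalRing.residue (RingInt K) x ^ n ≠ 1) :
    ResiduallyNontorsion (algebraMap K (CompletedAlgClosure K) (x : K)) := by
  refine ⟨?_, fun n hn => ?_⟩
  · rw [norm_algebraMap_completedAlgClosure, norm_eq_one_of_residue_ne_zero hx0]
  · have h1 : IsLocalRing.residue (RingInt K) (x ^ n - 1) ≠ 0 := by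
      rw [map_sub, map_pow, map_one]
      exact sub_ne_zero.2 (hx n hn)
    have h2 := norm_eq_one_of_residue_ne_zero h1
    rw [← norm_algebraMap_completedAlgClosure] at h2
    simpa using h2

theorem norm_natCast_completedAlgClosure_eq_one {m : ℕ} (hm : ¬ ringChar (ResField K) ∣ m) :
    ‖(m : CompletedAlgClosure K)‖ = 1 := by
  have h1 : IsLocalRing.residue (RingInt K) (m : RingInt K) ≠ 0 := by
    rwa [map_natCast, Ne, ringChar.spec]
  have h2 := norm_eq_one_of_residue_ne_zero h1
  rw [← norm_algebraMap_completedAlgClosure] at h2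
  simpa using h2

theorem overCK_exampleMap (m : ℕ) (T : K) :
    overCK (exampleMap m T) = cyclotomicMap m (algebraMap K (CompletedAlgClosure K) T) := by
  rw [overCK, exampleMap_eq_cyclotomicMap, ratBaseChange_cyclotomicMap]

/-- The general statements about `cyclotomicMap`, transported to `exampleMap` over `ℂ_K`; a
non-torsion element of the residue field of `K` supplies the points that they require. -/
theorem exampleMap_properties (hk : ¬ IsAlgebraicOverFiniteField (ResField K)) {m : ℕ}
    (hm2 : 2 ≤ m) (hm : ¬ ringChar (ResField K) ∣ m) {T : K} (hT0 : 0 < ‖T‖) (hT1 : ‖T‖ < 1) :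
    HasNontrivialReduction (overCK (exampleMap m T)) (RatFunc.X ^ m) ∧
    JuliaMeetsInfinitelyManyClasses (exampleMap m T) ∧
    (∀ t : CompType, (wanderingGrandOrbits (overCK (exampleMap m T)) t).Infinite) ∧
    (∀ b : RingInt K,
      (Set.range fun n : ℤ => (IsLocalRing.residue (RingInt K) b) ^ n).Infinite →
      ∀ t : CompType,
        IsWanderingComponent (overCK (exampleMap m T)) t
          (residueClass (red
            (algebraMap K (CompletedAlgClosure K) (b : K) :
              OnePoint (CompletedAlgClosure K))))) := by
  have hm' := norm_natCast_completedAlgClosure_eq_one hm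
  rw [← norm_algebraMap_completedAlgClosure] at hT0 hT1
  have hT0' := norm_pos_iff.1 hT0
  obtain ⟨x, hx0, hx⟩ := exists_forall_pow_ne_one hk
  obtain ⟨x, rfl⟩ := IsLocalRing.residue_surjective x
  have hu := residuallyNontorsion_algebraMap hx0 hx
  rw [JuliaMeetsInfinitelyManyClasses, overCK_exampleMap]
  refine ⟨hasNontrivialReduction_cyclotomicMap hm2 hT1, ?_,
    infinite_wanderingGrandOrbits hm2 hm' hT0' hT1 hu, fun b hb t => ?_⟩
  · obtain ⟨c, hc, hJ, -⟩ := exists_residueClass_seq hm2 hm' hT0' hT1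
      ⟨hu.1, hu.2 m (by omega)⟩
      (by simpa using hu.norm_pow_sub_pow (i := m) (j := 1) (by omega))
    exact Set.infinite_of_injective_forall_mem hc hJ
  · obtain ⟨hb0, hb'⟩ := ne_zero_and_forall_pow_ne_one_of_infinite_range_zpow hb
    have hb'' := residuallyNontorsion_algebraMap hb0 hb'
    rw [residueClass_red_coe hb''.1.le]
    exact isWanderingComponent_openDisk hm2 hm' hT0' hT1 hb'' t

end Main

theorem theoremA (K : Type*) [NontriviallyNormedField K] [IsUltrametricDist K] [CompleteSpace K]
    (hk : ¬ IsAlgebraicOverFiniteField (ResField K)) :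
    (∃ φ : RatFunc K,
      (∃ ψ : RatFunc (ResField (CompletedAlgClosure K)),
        HasNontrivialReduction (overCK φ) ψ ∧ 2 ≤ ratDegree ψ) ∧
      JuliaMeetsInfinitelyManyClasses φ) ∧
    (∀ m : ℕ, 2 ≤ m → ¬ ringChar (ResField K) ∣ m → ∀ T : K, 0 < ‖T‖ → ‖T‖ < 1 →
      HasNontrivialReduction (overCK (exampleMap m T)) (RatFunc.X ^ m) ∧
      JuliaMeetsInfinitelyManyClasses (exampleMap m T) ∧
      (∀ t : CompType, (wanderingGrandOrbits (overCK (exampleMap m T)) t).Infinite) ∧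
      (∀ b : RingInt K,
        (Set.range fun n : ℤ => (IsLocalRing.residue (RingInt K) b) ^ n).Infinite →
        ∀ t : CompType,
          IsWanderingComponent (overCK (exampleMap m T)) t
            (residueClass (red
              (algebraMap K (CompletedAlgClosure K) (b : K) :
                OnePoint (CompletedAlgClosure K)))))) := by
  refine ⟨?_, fun m hm2 hm T hT0 hT1 => exampleMap_properties hk hm2 hm hT0 hT1⟩
  obtain ⟨m, hm2, hm⟩ : ∃ m, 2 ≤ m ∧ ¬ ringChar (ResField K) ∣ m := by
    by_cases h2 : ringChar (ResField K) ∣ 2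
    · refine ⟨3, by norm_num, fun h3 => ?_⟩
      have h1 := Nat.dvd_sub h3 h2
      exact CharP.ringChar_ne_one (Nat.dvd_one.1 h1)
    · exact ⟨2, le_rfl, h2⟩
  obtain ⟨T, hT0, hT1⟩ := NormedField.exists_norm_lt_one K
  obtain ⟨h1, h2, -⟩ := exampleMap_properties hk hm2 hm hT0 hT1
  exact ⟨exampleMap m T, ⟨RatFunc.X ^ m, h1, by rwa [ratDegree_X_pow]⟩, h2⟩
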